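/- Let $G$ be a locally compact (Hausdorff) Abelian group with Haar measure $dx$, and let $w:G\to(0,\infty)$ be a weight, i.e. a Borel measurable function with $w(xy)\le w(x)w(y)$ for all $x,y\in G$. Let $L^1(G,w)$ be the Banach algebra of (classes of) Borel measurable functions $f:G\to\mathbb C$ with $\|f\|_{1,w}=\int_G|f(x)|\,w(x)\,dx<\infty$, under the convolution $(f\star g)(x)=\int_G f(y)g(y^{-1}x)\,dy$. Let $\Delta(L^1(G,w))$ be its character space, i.e. the set of nonzero multiplicative (continuous) linear functionals with the weak-$*$ topology, and let $\Gamma_w:L^1(G,w)\to C_0(\Delta(L^1(G,w)))$, $\Gamma_w(f)(\varphi)=\varphi(f)$, be the Gelfand map. Then the following are equivalent: (i) $\Gamma_w$ is surjective; (ii) $L^1(G)=C_0(\widehat G)$, i.e. the Gelfand (Fourier) transform $f\mapsto\hat f$, $\hat f(\chi)=\int_G\overline{\chi(x)}f(x)\,dx$, is a bijection of $L^1(G)$ onto $C_0(\widehat G)$, where $\widehat G$ is the Pontryagin dual of $G$ with the compact-open topology; (iii) $G$ is finite. -/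

import Mathlib

open MeasureTheory Topology
open scoped ZeroAtInfty ComplexConjugate

namespace WeightedGroupAlgebra

/-- A weight on `G`: a Borel measurable function `w : G → (0, ∞)` with `w (x y) ≤ w x * w y`. -/
structure IsWeight {G : Type*} [Group G] [MeasurableSpace G] (w : G → ℝ) : Prop where
  measurable : Measurable w
  pos : ∀ x, 0 < w x
  submultiplicative : ∀ x y, w (x * y) ≤ w x * w y

/-- The Banach space `L¹(G, w)` of (classes of) measurable functions `f : G → ℂ` with
`‖f‖ = ∫ |f x| w x dμ x < ∞`. As `w` is positive everywhere, the measures `w μ` and `μ` have the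
same null sets. -/
abbrev L1w {G : Type*} [MeasurableSpace G] (μ : Measure G) (w : G → ℝ) : Type _ :=
  Lp ℂ 1 (μ.withDensity fun x => ENNReal.ofReal (w x))

/-- The convolution `(f ⋆ g) x = ∫ f y * g (y⁻¹ x) dy` with respect to the Haar measure `μ`
(not `w μ`). -/
noncomputable def conv {G : Type*} [Group G] [MeasurableSpace G] (μ : Measure G)
    (f g : G → ℂ) : G → ℂ :=
  fun x => ∫ y, f y * g (y⁻¹ * x) ∂μ

/-- The character space `Δ(L¹(G, w))` with the Gelfand (weak-*) topology: the nonzero continuous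
linear functionals that are multiplicative for convolution. The element `h` below is the class of
the function `f ⋆ g`. -/
def characterSpace {G : Type*} [Group G] [MeasurableSpace G] (μ : Measure G) (w : G → ℝ) :
    Set (WeakDual ℂ (L1w μ w)) :=
  {φ | φ ≠ 0 ∧ ∀ f g h : L1w μ w, ⇑h =ᵐ[μ] conv μ f g → φ h = φ f * φ g}

/-- The Gelfand transform `f ↦ (φ ↦ φ f)` of `L¹(G, w)`. -/
noncomputable def gelfandTransform {G : Type*} [Group G] [MeasurableSpace G] (μ : Measure G) (w : G → ℝ)
    (f : L1w μ w) : characterSpace μ w → ℂ :=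
  fun φ => (φ : WeakDual ℂ (L1w μ w)) f

/-- The Fourier transform (the Gelfand transform of `L¹(G)`, with its character space written as
the dual group): `f ↦ (χ ↦ ∫ conj (χ x) * f x dx)`. -/
noncomputable def fourierTransform {G : Type*} [CommGroup G] [TopologicalSpace G]
    [MeasurableSpace G] (μ : Measure G) (f : Lp ℂ 1 μ) : PontryaginDual G → ℂ :=
  fun χ => ∫ x, conj (χ x : ℂ) * f x ∂μ

end WeightedGroupAlgebra

/-! Either surjectivity statement forces finiteness through a Banach space obstruction: `L¹` has
cotype two, while `C₀(X)` with `X` infinite does not. If contractive functionals indexed by `X`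
separate `L¹` and realise all of `C₀(X)`, the inverse `T : C₀(X) → L¹` is bounded by the closed
graph theorem. For `n` disjoint bumps on `X`, all signed sums have norm at most one, while the
images under `T` have norm at least one; Khinchine's inequality, integrated, gives `n ≤ 2‖T‖√n`,
absurd for large `n`. So `X` is finite, `L¹` embeds in `ℂ^X`, and disjoint bumps on `G` show that
`G` is finite (`finite_of_surjective_evaluation`, `finite_of_finiteDimensional_L1`).

For the Fourier transform, injectivity is part of the hypothesis. For the Gelfand map it is the
semisimplicity of `L¹(G, w)` (`IsWeight.eq_zero_of_forall_character`). A Hahn-Banach argument for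
`log w` yields a continuous homomorphism `α : G → (0, ∞)` with `α ≤ w`. Translation on `L²(G)`
twisted by `α` integrates to a faithful representation of `L¹(G, w)` by commuting normal operators,
and Gelfand theory for the commutative C⋆-algebra they generate supplies the characters. Since Haar
measure need not be σ-finite, multiplicativity is checked on `C_c(G)`, where Fubini is safe, and
extended by absolutely convergent series.

Conversely, on a finite group distinct characters are linearly independent, so a transform can take
any prescribed values; for the Fourier transform, comparing the orders of `G` and its dual gives
injectivity. -/

namespace WeightedGroupAlgebra

/-! ### Khinchine's inequality and cotype two of `L¹`. -/

section Khinchine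

/-- The sum of the `a i`, `i ∈ s`, with sign `+` for `i ∈ t` and `-` otherwise. -/
def signedSum {ι E : Type*} [DecidableEq ι] [AddCommGroup E] (a : ι → E) (s t : Finset ι) : E :=
  ∑ i ∈ s, if i ∈ t then a i else -a i

/-- Every choice of signs on `s` extends to `insert j s` in two ways. This recursion drives the
inductive computation of both moments below. -/
theorem sum_powerset_insert_signedSum {ι E : Type*} [DecidableEq ι] [AddCommGroup E] (a : ι → E)
    (F : E → ℝ) {s : Finset ι} {j : ι} (hj : j ∉ s) :
    ∑ t ∈ (insert j s).powerset, F (signedSum a (insert j s) t) =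
      ∑ t ∈ s.powerset, (F (signedSum a s t + a j) + F (signedSum a s t - a j)) := by
  rw [Finset.sum_powerset_insert hj, add_comm, ← Finset.sum_add_distrib]
  refine Finset.sum_congr rfl fun t ht => ?_
  have hjt : j ∉ t := fun h => hj (Finset.mem_powerset.1 ht h)
  have h1 : signedSum a (insert j s) (insert j t) = signedSum a s t + a j := by
    unfold signedSum
    rw [Finset.sum_insert hj, add_comm]
    congr 1
    · refine Finset.sum_congr rfl fun i hi => ?_
      have : i ≠ j := fun h => hj (h ▸ hi)
      simp [this]
    · simp
  have h2 : signedSum a (insert j s) t = signedSum a s t - a j := by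
    unfold signedSum
    rw [Finset.sum_insert hj, add_comm, sub_eq_add_neg]
    simp [hjt]
  rw [h1, h2]

theorem sum_norm_signedSum_sq {ι : Type*} [DecidableEq ι] (a : ι → ℂ) (s : Finset ι) :
    ∑ t ∈ s.powerset, ‖signedSum a s t‖ ^ 2 = 2 ^ s.card * ∑ i ∈ s, ‖a i‖ ^ 2 := by
  induction s using Finset.induction_on with
  | empty => simp [signedSum]
  | insert j s hj ih =>
    rw [sum_powerset_insert_signedSum a (fun z => ‖z‖ ^ 2) hj]
    have h : ∀ x y : ℂ, ‖x + y‖ ^ 2 + ‖x - y‖ ^ 2 = 2 * (‖x‖ ^ 2 + ‖y‖ ^ 2) := fun x y => by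
      have := parallelogram_law_with_norm ℝ x y
      nlinarith
    simp_rw [h, ← Finset.mul_sum, Finset.sum_add_distrib, ih, Finset.sum_insert hj,
      Finset.card_insert_of_notMem hj]
    simp
    ring

theorem norm_add_pow_four_add_norm_sub_pow_four_le (x y : ℂ) :
    ‖x + y‖ ^ 4 + ‖x - y‖ ^ 4 ≤ 2 * (‖x‖ ^ 4 + 6 * (‖x‖ ^ 2 * ‖y‖ ^ 2) + ‖y‖ ^ 4) := by
  have h1 := @norm_add_sq_real ℂ _ _ x y
  have h2 := @norm_sub_sq_real ℂ _ _ x y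
  have h3 := abs_real_inner_le_norm x y
  have h4 : (inner ℝ x y) ^ 2 ≤ ‖x‖ ^ 2 * ‖y‖ ^ 2 := by
    rw [← mul_pow, ← sq_abs]
    gcongr
  calc ‖x + y‖ ^ 4 + ‖x - y‖ ^ 4 = (‖x + y‖ ^ 2) ^ 2 + (‖x - y‖ ^ 2) ^ 2 := by ring
    _ ≤ _ := by rw [h1, h2]; nlinarith

/-- Induction on `s`: the cross term `6‖x‖²‖y‖²` is exactly the one in the expansion of `3(σ² +
‖y‖²)²`, which explains the constant 3. -/
theorem sum_norm_signedSum_pow_four_le {ι : Type*} [DecidableEq ι] (a : ι → ℂ) (s : Finset ι) :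
    ∑ t ∈ s.powerset, ‖signedSum a s t‖ ^ 4 ≤ 2 ^ s.card * (3 * (∑ i ∈ s, ‖a i‖ ^ 2) ^ 2) := by
  induction s using Finset.induction_on with
  | empty => simp [signedSum]
  | insert j s hj ih =>
    rw [sum_powerset_insert_signedSum a (fun z => ‖z‖ ^ 4) hj]
    refine (Finset.sum_le_sum fun t _ =>
      norm_add_pow_four_add_norm_sub_pow_four_le (signedSum a s t) (a j)).trans ?_
    simp_rw [← Finset.mul_sum, Finset.sum_add_distrib, ← Finset.mul_sum, ← Finset.sum_mul,
      sum_norm_signedSum_sq, Finset.sum_insert hj, Finset.card_insert_of_notMem hj]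
    simp only [Finset.sum_const, Finset.card_powerset, nsmul_eq_mul, Nat.cast_pow, Nat.cast_ofNat]
    have : (0 : ℝ) ≤ 2 ^ s.card * ‖a j‖ ^ 4 := by positivity
    rw [pow_succ (2 : ℝ)]
    nlinarith

/-- Khinchine's inequality for `L¹` with a crude constant. -/
theorem sqrt_le_sum_norm_signedSum {ι : Type*} [DecidableEq ι] (a : ι → ℂ) (s : Finset ι) :
    2 ^ s.card * √(∑ i ∈ s, ‖a i‖ ^ 2) ≤ 2 * ∑ t ∈ s.powerset, ‖signedSum a s t‖ := by
  set σ := √(∑ i ∈ s, ‖a i‖ ^ 2) with hσ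
  have hσ2 : ∑ i ∈ s, ‖a i‖ ^ 2 = σ ^ 2 := by rw [hσ, Real.sq_sqrt (by positivity)]
  rcases (Real.sqrt_nonneg (∑ i ∈ s, ‖a i‖ ^ 2)).eq_or_lt with h0 | hpos
  · rw [hσ, ← h0, mul_zero]
    positivity
  rw [← hσ] at hpos
  have h2 := sum_norm_signedSum_sq a s
  have h4 := sum_norm_signedSum_pow_four_le a s
  rw [hσ2] at h2 h4
  -- The difference of the two sides is `t(t - 2σ)²(t + 4σ)`. Summed over signs, this bounds the
  -- first moment below by the second and fourth: `12 - 3 = 9`, and `9/16 ≥ 1/2`.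
  have key : ∀ t : ℝ, 0 ≤ t → 12 * σ ^ 2 * t ^ 2 - t ^ 4 ≤ 16 * σ ^ 3 * t := fun t ht => by
    have : 0 ≤ t * (t - 2 * σ) ^ 2 * (t + 4 * σ) := by positivity
    nlinarith
  have := Finset.sum_le_sum fun t (_ : t ∈ s.powerset) =>
    key ‖signedSum a s t‖ (norm_nonneg _)
  rw [Finset.sum_sub_distrib, ← Finset.mul_sum, ← Finset.mul_sum, h2] at this
  have h5 : σ ^ 3 * (9 * (2 ^ s.card * σ)) ≤ σ ^ 3 * (16 * ∑ t ∈ s.powerset, ‖signedSum a s t‖) := by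
    nlinarith
  have h6 := le_of_mul_le_mul_left h5 (by positivity)
  have : 0 ≤ 2 ^ s.card * σ := by positivity
  linarith

theorem sum_norm_le_sum_norm_signedSum {ι : Type*} [DecidableEq ι] (a : ι → ℂ) (s : Finset ι) :
    2 ^ s.card * ∑ i ∈ s, ‖a i‖ ≤ √s.card * (2 * ∑ t ∈ s.powerset, ‖signedSum a s t‖) := by
  have h1 : ∑ i ∈ s, ‖a i‖ ≤ √s.card * √(∑ i ∈ s, ‖a i‖ ^ 2) := by
    rw [← Real.sqrt_mul (by positivity)]
    exact Real.le_sqrt_of_sq_le sq_sum_le_card_mul_sum_sq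
  calc _ ≤ 2 ^ s.card * (√s.card * √(∑ i ∈ s, ‖a i‖ ^ 2)) := by gcongr
    _ = √s.card * (2 ^ s.card * √(∑ i ∈ s, ‖a i‖ ^ 2)) := by ring
    _ ≤ _ := mul_le_mul_of_nonneg_left (sqrt_le_sum_norm_signedSum a s) (by positivity)

theorem coeFn_signedSum {Ω ι : Type*} [MeasurableSpace Ω] [DecidableEq ι] {ν : Measure Ω}
    (f : ι → Lp ℂ 1 ν) (s t : Finset ι) :
    ⇑(signedSum f s t) =ᵐ[ν] fun x => signedSum (fun i => f i x) s t := by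
  unfold signedSum
  induction s using Finset.induction_on with
  | empty => exact Lp.coeFn_zero ℂ 1 ν
  | insert j s hj ih =>
    rw [Finset.sum_insert hj]
    filter_upwards [Lp.coeFn_add (if j ∈ t then f j else -f j)
      (∑ i ∈ s, if i ∈ t then f i else -f i), ih, Lp.coeFn_neg (f j)] with x h1 h2 h3
    rw [h1, Pi.add_apply, h2, Finset.sum_insert hj]
    split_ifs
    · rfl
    · rw [h3]; rfl

/-- `L¹` has cotype two, in a weak form. -/
theorem sum_norm_le_of_norm_signedSum_le {Ω ι : Type*} [MeasurableSpace Ω] [DecidableEq ι]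
    {ν : Measure Ω} (f : ι → Lp ℂ 1 ν) (s : Finset ι) {C : ℝ}
    (hC : ∀ t, ‖signedSum f s t‖ ≤ C) : ∑ i ∈ s, ‖f i‖ ≤ √s.card * (2 * C) := by
  have hint : ∀ t, Integrable (fun x => ‖signedSum (fun i => f i x) s t‖) ν := fun t =>
    ((L1.integrable_coeFn (signedSum f s t)).congr (coeFn_signedSum f s t)).norm
  have hnorm : ∀ t, ‖signedSum f s t‖ = ∫ x, ‖signedSum (fun i => f i x) s t‖ ∂ν := fun t => by
    rw [L1.norm_eq_integral_norm]
    exact integral_congr_ae ((coeFn_signedSum f s t).fun_comp norm)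
  -- The scalar inequality holds at every point, so it can be integrated.
  have key : 2 ^ s.card * ∑ i ∈ s, ‖f i‖ ≤
      √s.card * (2 * ∑ t ∈ s.powerset, ‖signedSum f s t‖) := by
    simp_rw [hnorm, L1.norm_eq_integral_norm]
    rw [← integral_finsetSum _ fun i _ => (L1.integrable_coeFn (f i)).norm,
      ← integral_finsetSum _ fun t _ => hint t, ← integral_const_mul, ← integral_const_mul,
      ← integral_const_mul]
    refine integral_mono ?_ ?_ fun x => sum_norm_le_sum_norm_signedSum (fun i => f i x) s
    · exact (integrable_finsetSum _ fun i _ => (L1.integrable_coeFn (f i)).norm).const_mul _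
    · exact ((integrable_finsetSum _ fun t _ => hint t).const_mul _).const_mul _
  have h2 : ∑ t ∈ s.powerset, ‖signedSum f s t‖ ≤ 2 ^ s.card * C := by
    refine (Finset.sum_le_sum fun t _ => hC t).trans ?_
    simp
  have h3 : (2 : ℝ) ^ s.card * ∑ i ∈ s, ‖f i‖ ≤ 2 ^ s.card * (√s.card * (2 * C)) := by
    refine key.trans ?_
    have : √s.card * (2 * ∑ t ∈ s.powerset, ‖signedSum f s t‖) ≤
      √s.card * (2 * (2 ^ s.card * C)) := by gcongr
    linarith
  exact le_of_mul_le_mul_left h3 (by positivity)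

end Khinchine

/-! ### The obstruction: `L¹` against `C₀(X)`, and finite-dimensional `L¹`. -/

theorem exists_disjoint_bumps {X : Type*} [TopologicalSpace X] [T2Space X] [LocallyCompactSpace X]
    (s : Finset X) : ∃ g : X → C(X, ℝ), (∀ i ∈ s, g i i = 1) ∧ (∀ i, HasCompactSupport (g i)) ∧
      (∀ i x, g i x ∈ Set.Icc (0 : ℝ) 1) ∧
      ∀ x, ∀ i ∈ s, ∀ j ∈ s, g i x ≠ 0 → g j x ≠ 0 → i = j := by
  obtain ⟨U, hU, hd⟩ := (s.finite_toSet).t2_separation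
  have := fun i => exists_continuous_one_zero_of_isCompact (isCompact_singleton (x := i))
    (hU i).2.isClosed_compl (Set.disjoint_singleton_left.2 (fun h => h (hU i).1))
  choose g h1 h0 hc hI using this
  refine ⟨g, fun i _ => h1 i rfl, hc, hI, fun x i hi j hj hxi hxj => ?_⟩
  have hm : ∀ i, g i x ≠ 0 → x ∈ U i := fun i h => by
    by_contra hx
    exact h (h0 i hx)
  by_contra hij
  exact Set.disjoint_left.1 (hd hi hj hij) (hm i hxi) (hm j hxj)

/-- The inverse of the evaluation map would carry disjoint bumps, whose signed sums stay bounded, to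
vectors of `L¹` whose signed sums must grow like the square root of their number. -/
theorem finite_of_surjective_evaluation {X Ω : Type*} [TopologicalSpace X] [T2Space X]
    [LocallyCompactSpace X] [MeasurableSpace Ω] {ν : Measure Ω} (e : X → Lp ℂ 1 ν →L[ℂ] ℂ)
    (hbound : ∀ x f, ‖e x f‖ ≤ ‖f‖) (hinj : ∀ f, (∀ x, e x f = 0) → f = 0)
    (hsurj : ∀ F : C₀(X, ℂ), ∃ f, ∀ x, e x f = F x) : Finite X := by
  choose S hS using hsurj
  have huniq : ∀ f g, (∀ x, e x f = e x g) → f = g := fun f g h => by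
    rw [← sub_eq_zero]
    exact hinj _ fun x => by rw [map_sub, h, sub_self]
  let T : C₀(X, ℂ) →ₗ[ℂ] Lp ℂ 1 ν :=
    { toFun := S
      map_add' := fun F H => huniq _ _ fun x => by simp [hS]
      map_smul' := fun c F => huniq _ _ fun x => by simp [hS] }
  -- Closed graph theorem: convergence in either space implies convergence of the values at each
  -- `x`, and these values determine the element of `L¹`.
  have hT : Continuous T := by
    refine T.continuous_of_seq_closed_graph fun u F f hu hTu => huniq _ _ fun x => ?_
    have h1 : Filter.Tendsto (fun n => u n x) Filter.atTop (𝓝 (e x f)) := by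
      have := ((e x).continuous.tendsto f).comp hTu
      refine this.congr fun n => ?_
      exact hS (u n) x
    have h2 : Filter.Tendsto (fun n => u n x) Filter.atTop (𝓝 (F x)) := by
      rw [tendsto_iff_norm_sub_tendsto_zero] at hu ⊢
      refine squeeze_zero (fun _ => norm_nonneg _) (fun n => ?_) hu
      exact (BoundedContinuousFunction.norm_coe_le_norm (u n - F).toBCF x)
    exact (tendsto_nhds_unique h1 h2).trans (hS F x).symm
  let T' : C₀(X, ℂ) →L[ℂ] Lp ℂ 1 ν := ⟨T, hT⟩
  by_contra hX
  rw [not_finite_iff_infinite] at hX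
  -- Chosen to contradict `n ≤ √n * (2 * ‖T'‖)`.
  obtain ⟨n, hn⟩ := exists_nat_gt ((2 * ‖T'‖) ^ 2)
  obtain ⟨s, hs⟩ := Infinite.exists_subset_card_eq X n
  classical
  obtain ⟨g, h1, hc, hI, hd⟩ := exists_disjoint_bumps s
  let G : X → C₀(X, ℂ) := fun i =>
    ⟨⟨fun x => (g i x : ℂ), by fun_prop⟩, ((hc i).comp_left (g := fun r : ℝ => (r : ℂ)) (by simp)).is_zero_at_infty⟩
  have hG : ∀ i x, G i x = (g i x : ℂ) := fun i x => rfl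
  -- At each point at most one bump is nonzero.
  have hle : ∀ t, ‖signedSum G s t‖ ≤ 1 := fun t => by
    refine BoundedContinuousFunction.norm_le (f := (signedSum G s t).toBCF) zero_le_one |>.2
      fun x => ?_
    have hx : (signedSum G s t).toBCF x = signedSum (fun i => (g i x : ℂ)) s t := by
      let ev : C₀(X, ℂ) →+ ℂ := ⟨⟨fun F => F x, rfl⟩, fun _ _ => rfl⟩
      change ev (signedSum G s t) = _
      unfold signedSum
      rw [map_sum]
      refine Finset.sum_congr rfl fun i _ => ?_
      split_ifs <;> rfl
    rw [hx]
    by_cases hex : ∃ i ∈ s, g i x ≠ 0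
    · obtain ⟨i, hi, hix⟩ := hex
      unfold signedSum
      rw [Finset.sum_eq_single_of_mem i hi]
      · have := hI i x
        have : ‖(g i x : ℂ)‖ ≤ 1 := by
          rw [Complex.norm_real, Real.norm_of_nonneg this.1]; exact this.2
        split_ifs <;> simpa using this
      · intro j hj hji
        have : g j x = 0 := by
          by_contra h
          exact hji (hd x j hj i hi h hix)
        simp [this]
    · push Not at hex
      unfold signedSum
      rw [Finset.sum_eq_zero]
      · simp
      · intro i hi
        simp [hex i hi]
  have hge : ∀ i ∈ s, 1 ≤ ‖T' (G i)‖ := fun i hi => by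
    refine le_trans ?_ (hbound i _)
    change 1 ≤ ‖e i (S (G i))‖
    rw [hS, hG, h1 i hi]; simp
  have hsum := sum_norm_le_of_norm_signedSum_le (fun i => T' (G i)) s (C := ‖T'‖) fun t => by
    have : signedSum (fun i => T' (G i)) s t = T' (signedSum G s t) := by
      unfold signedSum
      rw [map_sum]
      refine Finset.sum_congr rfl fun i _ => ?_
      split_ifs <;> simp
    rw [this]
    exact (T'.le_opNorm _).trans (mul_le_of_le_one_right (norm_nonneg _) (hle t))
  have h7 : (n : ℝ) ≤ √n * (2 * ‖T'‖) := by
    rw [← hs]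
    refine le_trans ?_ hsum
    simpa using Finset.sum_le_sum hge
  have h8 : 2 * ‖T'‖ < √n := Real.lt_sqrt_of_sq_lt hn
  have h9 : 0 < √(n : ℝ) := lt_of_le_of_lt (by positivity) h8
  have h10 : √(n : ℝ) * √n = n := Real.mul_self_sqrt (by positivity)
  nlinarith

/-- Disjoint bumps are linearly independent in `L¹`: a relation almost everywhere between continuous
functions holds everywhere, as open sets have positive measure, and can be evaluated at each centre.
-/
theorem finite_of_finiteDimensional_L1 {G : Type*} [TopologicalSpace G] [T2Space G]
    [LocallyCompactSpace G] [MeasurableSpace G] [BorelSpace G] {ν : Measure G}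
    [IsFiniteMeasureOnCompacts ν] [ν.IsOpenPosMeasure] [FiniteDimensional ℂ (Lp ℂ 1 ν)] :
    Finite G := by
  by_contra hX
  rw [not_finite_iff_infinite] at hX
  obtain ⟨s, hs⟩ := Infinite.exists_subset_card_eq G (Module.finrank ℂ (Lp ℂ 1 ν) + 1)
  obtain ⟨g, h1, hc, hI, hd⟩ := exists_disjoint_bumps s
  have hcont : ∀ i, Continuous fun x => (g i x : ℂ) := fun i => by fun_prop
  have hm : ∀ i, MemLp (fun x => (g i x : ℂ)) 1 ν := fun i =>
    (hcont i).memLp_of_hasCompactSupport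
      ((hc i).comp_left (g := fun r : ℝ => (r : ℂ)) (by simp))
  have hli : LinearIndependent ℂ fun i : s => (hm i).toLp := by
    rw [Fintype.linearIndependent_iff]
    intro c hc0 i
    have hae : (fun x => ∑ j : s, c j * (g j x : ℂ)) =ᵐ[ν] fun _ => 0 := by
      have h2 : ⇑(∑ j : s, c j • (hm j).toLp) =ᵐ[ν] fun x => ∑ j : s, c j * (g j x : ℂ) := by
        have h4 : ∀ᵐ x ∂ν, ∀ j : s, (c j • (hm j).toLp : Lp ℂ 1 ν) x = c j * (g j x : ℂ) :=
          ae_all_iff.2 fun j => by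
            filter_upwards [Lp.coeFn_smul (c j) (hm j).toLp, (hm j).coeFn_toLp] with x hx hx'
            rw [hx, Pi.smul_apply, hx', smul_eq_mul]
        filter_upwards [Lp.coeFn_finsetSum Finset.univ fun j : s => c j • (hm j).toLp, h4]
          with x hx hx'
        rw [hx, Finset.sum_apply]
        exact Finset.sum_congr rfl fun j _ => hx' j
      rw [hc0] at h2
      exact h2.symm.trans (Lp.coeFn_zero ℂ 1 ν)
    have := congrFun (Measure.eq_of_ae_eq hae (by fun_prop) continuous_const) (i : G)
    rw [Finset.sum_eq_single_of_mem i (Finset.mem_univ _), h1 i i.2] at this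
    · simpa using this
    · intro j _ hj
      have : g j i = 0 := by
        by_contra h
        exact hj (Subtype.ext (hd i j j.2 i i.2 h (by rw [h1 i i.2]; exact one_ne_zero)))
      simp [this]
  have := hli.fintype_card_le_finrank
  simp [hs] at this

end WeightedGroupAlgebra

namespace WeightedGroupAlgebra

/-! ### Additive minorants of subadditive functions. -/

section AdditiveMinorant

/-- Hahn-Banach for abelian groups: a superadditive function below a pointwise bound has an
additive majorant. -/
theorem exists_additive_le {G : Type*} [CommGroup G] (p : G → ℝ)
    (hp : ∀ x y, p (x * y) ≤ p x + p y) :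
    ∃ l : G → ℝ, (∀ x y, l (x * y) = l x + l y) ∧ ∀ x, l x ≤ p x := by
  -- Superadditive functions above `-p`, with `-p` itself among them. They are bounded pointwise by
  -- `p x⁻¹`, so Zorn's lemma applies; a maximal `r` turns out to be additive, and `-r` is the
  -- minorant.
  let S : Set (G → ℝ) := {r | (∀ x y, r x + r y ≤ r (x * y)) ∧ ∀ x, -p x ≤ r x}
  have hbound : ∀ r ∈ S, ∀ x, r x ≤ -r x⁻¹ := fun r hr x => by
    have h1 := hr.1 x x⁻¹
    have h2 := hr.1 1 1
    rw [mul_inv_cancel] at h1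
    rw [mul_one] at h2
    linarith
  have hbound' : ∀ r ∈ S, ∀ x, r x ≤ p x⁻¹ := fun r hr x => by
    have := hbound r hr x
    have := hr.2 x⁻¹
    linarith
  obtain ⟨r, -, hr⟩ := zorn_le_nonempty₀ S (fun c hc hchain r₀ hr₀ => by
    have : Nonempty c := ⟨⟨r₀, hr₀⟩⟩
    have hbdd : ∀ x, BddAbove (Set.range fun r : c => (r : G → ℝ) x) := fun x =>
      ⟨p x⁻¹, by rintro _ ⟨r, rfl⟩; exact hbound' r (hc r.2) x⟩
    have hle : ∀ (r : c) x, (r : G → ℝ) x ≤ ⨆ r : c, (r : G → ℝ) x := fun r x =>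
      le_ciSup (hbdd x) r
    refine ⟨fun x => ⨆ r : c, (r : G → ℝ) x, ⟨fun x y => ?_, fun x => ?_⟩,
      fun r hr x => hle ⟨r, hr⟩ x⟩
    · rw [← le_sub_iff_add_le]
      refine ciSup_le fun r₁ => ?_
      rw [le_sub_comm]
      refine ciSup_le fun r₂ => ?_
      rw [le_sub_iff_add_le, add_comm]
      rcases hchain.total r₁.2 r₂.2 with h | h
      · exact (add_le_add_left (h x) _).trans (((hc r₂.2).1 x y).trans (hle r₂ _))
      · exact (add_le_add_right (h y) _).trans (((hc r₁.2).1 x y).trans (hle r₁ _))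
    · exact ((hc hr₀).2 x).trans (hle ⟨r₀, hr₀⟩ x)) (fun x => -p x)
    ⟨fun x y => by linarith [hp x y], fun x => le_rfl⟩
  have hrS := hr.prop
  have hmax : ∀ r' ∈ S, (∀ x, r x ≤ r' x) → ∀ x, r' x ≤ r x := fun r' hr' h => hr.le_of_ge hr' h
  have hpow : ∀ x (k : ℕ), (k + 1 : ℝ) * r x ≤ r (x ^ (k + 1)) := fun x k => by
    induction k with
    | zero => simp
    | succ k ih =>
      have := hrS.1 (x ^ (k + 1)) x
      rw [← pow_succ] at this
      push_cast
      linarith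
  have hhom : ∀ x (k : ℕ), r (x ^ (k + 1)) = (k + 1 : ℝ) * r x := fun x k => by
    refine le_antisymm ?_ (hpow x k)
    have hk : (0 : ℝ) < k + 1 := by positivity
    -- The competitor `x ↦ r (x ^ (k + 1)) / (k + 1)` is superadditive because `G` is abelian;
    -- maximality gives homogeneity.
    have hle : ∀ x, r x ≤ r (x ^ (k + 1)) / (k + 1) := fun x => by
      rw [le_div_iff₀' hk]; exact hpow x k
    have := hmax (fun x => r (x ^ (k + 1)) / (k + 1)) ⟨fun x y => by
      beta_reduce
      rw [← add_div, mul_pow]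
      gcongr
      exact hrS.1 _ _, fun x => (hrS.2 x).trans (hle x)⟩ hle x
    rwa [div_le_iff₀' hk] at this
  have hone : r 1 = 0 := by
    have := hhom 1 1
    simp only [one_pow] at this
    push_cast at this
    linarith
  have hhom' : ∀ x (k : ℕ), r (x ^ k) = k * r x := fun x k => by
    cases k with
    | zero => simp [hone]
    | succ k => rw [hhom]; push_cast; ring
  have hadd : ∀ x a, r (x * a) = r x + r a := fun x a => by
    refine le_antisymm ?_ (hrS.1 x a)
    -- The supremum over `n` of `r (x * a ^ n) - n * r a` is a second competitor. Homogeneity makes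
    -- it finite, and its term `n = 1` turns maximality into `r (x * a) ≤ r x + r a`.
    have hbdd : ∀ x, BddAbove (Set.range fun n : ℕ => r (x * a ^ n) - n * r a) := fun x =>
      ⟨-r x⁻¹, by
        rintro _ ⟨n, rfl⟩
        have := hrS.1 (x * a ^ n) x⁻¹
        rw [mul_right_comm, mul_inv_cancel, one_mul, hhom'] at this
        simp only
        linarith⟩
    have hle : ∀ x (n : ℕ), r (x * a ^ n) - n * r a ≤ ⨆ n : ℕ, (r (x * a ^ n) - n * r a) :=
      fun x n => le_ciSup (hbdd x) n
    have hle0 : ∀ x, r x ≤ ⨆ n : ℕ, (r (x * a ^ n) - n * r a) := fun x => by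
      simpa using hle x 0
    have := (hle x 1).trans (hmax (fun x => ⨆ n : ℕ, (r (x * a ^ n) - n * r a)) ⟨fun x y => by
      rw [← le_sub_iff_add_le]
      refine ciSup_le fun n => ?_
      rw [le_sub_comm]
      refine ciSup_le fun m => ?_
      rw [le_sub_iff_add_le]
      refine le_trans ?_ (hle (x * y) (n + m))
      have := hrS.1 (x * a ^ n) (y * a ^ m)
      rw [mul_mul_mul_comm, ← pow_add] at this
      push_cast
      linarith, fun x => (hrS.2 x).trans (hle0 x)⟩ hle0 x)
    simp only [pow_one, Nat.cast_one, one_mul] at this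
    linarith
  exact ⟨fun x => -r x, fun x y => by beta_reduce; rw [hadd]; ring, fun x => by linarith [hrS.2 x]⟩

end AdditiveMinorant

/-! ### Local bounds for weights and a continuous homomorphism below. -/

section Weight

theorem IsWeight.one_le_one {G : Type*} [Group G] [MeasurableSpace G] {w : G → ℝ}
    (hw : IsWeight w) : 1 ≤ w 1 := by
  have h := hw.submultiplicative 1 1
  rw [mul_one] at h
  have := hw.pos 1
  nlinarith

variable {G : Type*} [CommGroup G] [TopologicalSpace G] [IsTopologicalGroup G]
    [LocallyCompactSpace G] [T2Space G] [MeasurableSpace G] [BorelSpace G]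
    (μ : Measure G) [μ.IsHaarMeasure] [μ.Regular] {w : G → ℝ}

include μ in
-- Steinhaus: some set on which `w x` and `w x⁻¹` are both at most `n` has positive finite measure,
-- so its quotients `a / b` fill a neighbourhood of 1, and there `w ≤ n * n`.
theorem IsWeight.exists_forall_nhds_one_le (hw : IsWeight w) : ∃ C, ∀ᶠ x in 𝓝 (1 : G), w x ≤ C := by
  obtain ⟨K, hK, hK1⟩ := exists_compact_mem_nhds (1 : G)
  let E : ℕ → Set G := fun n => K ∩ {x | w x ≤ n ∧ w x⁻¹ ≤ n}
  have hEm : ∀ n, MeasurableSet (E n) := fun n => hK.measurableSet.inter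
    ((measurableSet_le hw.measurable measurable_const).inter
      (measurableSet_le (hw.measurable.comp measurable_inv) measurable_const))
  have hU : ⋃ n, E n = K := by
    refine Set.Subset.antisymm (Set.iUnion_subset fun n => Set.inter_subset_left) fun x hx => ?_
    obtain ⟨n, hn⟩ := exists_nat_ge (max (w x) (w x⁻¹))
    exact Set.mem_iUnion.2 ⟨n, hx, (le_max_left _ _).trans hn, (le_max_right _ _).trans hn⟩
  have hpos : ∃ n, 0 < μ (E n) := by
    by_contra! h
    have : μ K = 0 := by
      rw [← hU]
      exact measure_iUnion_null fun n => le_antisymm (h n) zero_le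
    exact (Measure.measure_pos_of_mem_nhds μ hK1).ne' this
  obtain ⟨n, hn⟩ := hpos
  have hfin : μ (E n) ≠ ⊤ := ((measure_mono Set.inter_subset_left).trans_lt hK.measure_lt_top).ne
  refine ⟨n * n, Filter.mem_of_superset
    (Measure.div_mem_nhds_one_of_haar_pos_ne_top μ (E n) (hEm n) hn hfin) ?_⟩
  rintro _ ⟨a, ha, b, hb, rfl⟩
  simp only [Set.mem_ofPred_eq, div_eq_mul_inv]
  exact (hw.submultiplicative a b⁻¹).trans
    (mul_le_mul ha.2.1 hb.2.2 (hw.pos _).le (Nat.cast_nonneg n))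

include μ in
theorem IsWeight.exists_forall_mem_le (hw : IsWeight w) {K : Set G} (hK : IsCompact K) :
    ∃ C, 0 < C ∧ ∀ x ∈ K, w x ≤ C := by
  obtain ⟨C, hC⟩ := hw.exists_forall_nhds_one_le μ
  have : ∃ C, ∀ x ∈ K, w x ≤ C := by
    refine hK.induction_on (p := fun s => ∃ C, ∀ x ∈ s, w x ≤ C) ⟨0, by simp⟩
      (fun s t hst ⟨C, hC⟩ => ⟨C, fun x hx => hC x (hst hx)⟩)
      (fun s t ⟨C, hC⟩ ⟨D, hD⟩ => ⟨max C D, fun x hx => ?_⟩) fun a _ => ?_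
    · rcases hx with hx | hx
      · exact (hC x hx).trans (le_max_left _ _)
      · exact (hD x hx).trans (le_max_right _ _)
    · have ht : Filter.Tendsto (fun x => a⁻¹ * x) (𝓝 a) (𝓝 1) := by
        have : Continuous fun x => a⁻¹ * x := by fun_prop
        simpa using this.tendsto a
      refine ⟨{x | w (a⁻¹ * x) ≤ C}, mem_nhdsWithin_of_mem_nhds (ht.eventually hC), w a * C,
        fun x hx => ?_⟩
      have := hw.submultiplicative a (a⁻¹ * x)
      rw [mul_inv_cancel_left] at this
      exact this.trans (mul_le_mul_of_nonneg_left hx (hw.pos a).le)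
  obtain ⟨C, hC⟩ := this
  exact ⟨max C 1, by positivity, fun x hx => (hC x hx).trans (le_max_left _ _)⟩

include μ in
-- Follows from the upper bound on `K⁻¹` and `1 ≤ w 1 ≤ w x * w x⁻¹`.
theorem IsWeight.exists_forall_mem_ge (hw : IsWeight w) {K : Set G} (hK : IsCompact K) :
    ∃ c, 0 < c ∧ ∀ x ∈ K, c ≤ w x := by
  obtain ⟨C, hC0, hC⟩ := hw.exists_forall_mem_le μ hK.inv
  refine ⟨C⁻¹, by positivity, fun x hx => ?_⟩
  have h1 := hw.submultiplicative x x⁻¹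
  rw [mul_inv_cancel] at h1
  have h2 := hC x⁻¹ (Set.inv_mem_inv.2 hx)
  rw [inv_le_iff_one_le_mul₀ hC0]
  exact hw.one_le_one.trans (h1.trans (mul_le_mul_of_nonneg_left h2 (hw.pos x).le))

include μ in
/-- A weight dominates a continuous homomorphism into the positive reals. -/
theorem IsWeight.exists_continuous_mul_le (hw : IsWeight w) :
    ∃ α : G → ℝ, Continuous α ∧ (∀ x, 0 < α x) ∧ (∀ x y, α (x * y) = α x * α y) ∧
      ∀ x, α x ≤ w x := by
  obtain ⟨l, hl, hlw⟩ := exists_additive_le (fun x => Real.log (w x)) fun x y => by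
    rw [← Real.log_mul (hw.pos x).ne' (hw.pos y).ne']
    exact Real.log_le_log (hw.pos _) (hw.submultiplicative x y)
  obtain ⟨C, hC⟩ := hw.exists_forall_nhds_one_le μ
  have h1 : l 1 = 0 := by have := hl 1 1; rw [mul_one] at this; linarith
  have hinv : ∀ x, l x⁻¹ = -l x := fun x => by
    have := hl x x⁻¹
    rw [mul_inv_cancel, h1] at this
    linarith
  have hpow : ∀ x (n : ℕ), l (x ^ n) = n * l x := fun x n => by
    induction n with
    | zero => simp [h1]
    | succ n ih => rw [pow_succ, hl, ih]; push_cast; ring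
  have hlC : ∀ᶠ x in 𝓝 (1 : G), l x ≤ Real.log C := hC.mono fun x hx =>
    (hlw x).trans (Real.log_le_log (hw.pos x) hx)
  -- An additive function bounded above near 1 is continuous there: the bound applied to `x ^ (n +
  -- 1)` and its inverse gives `|l x| ≤ log C / (n + 1)`.
  have ht1 : Filter.Tendsto l (𝓝 1) (𝓝 0) := by
    rw [Metric.tendsto_nhds]
    intro ε hε
    obtain ⟨n, hn⟩ := exists_nat_gt (Real.log C / ε)
    have hp : Filter.Tendsto (fun x : G => x ^ (n + 1)) (𝓝 1) (𝓝 1) := by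
      have : Continuous fun x : G => x ^ (n + 1) := by fun_prop
      simpa using this.tendsto 1
    have hi : Filter.Tendsto (fun x : G => x⁻¹) (𝓝 1) (𝓝 1) := by
      simpa using (continuous_inv (G := G)).tendsto 1
    filter_upwards [hp.eventually hlC, (hp.comp hi).eventually hlC] with x hx hx'
    simp only [Function.comp_apply] at hx'
    rw [hpow] at hx hx'
    rw [hinv] at hx'
    rw [div_lt_iff₀ hε] at hn
    push_cast at hx hx'
    have hnn : (0 : ℝ) < n + 1 := by positivity
    rw [Real.dist_eq, sub_zero, abs_lt]
    constructor <;> by_contra! hcon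
    · nlinarith
    · nlinarith
  have hcont : Continuous l := by
    rw [continuous_iff_continuousAt]
    intro a
    have ht : Filter.Tendsto (fun x => a⁻¹ * x) (𝓝 a) (𝓝 1) := by
      have : Continuous fun x => a⁻¹ * x := by fun_prop
      simpa using this.tendsto a
    have := (ht1.comp ht).const_add (l a)
    rw [add_zero] at this
    refine this.congr fun x => ?_
    simp only [Function.comp_apply]
    rw [← hl, mul_inv_cancel_left]
  refine ⟨fun x => Real.exp (l x), by fun_prop, fun x => Real.exp_pos _, fun x y => by
    beta_reduce; rw [hl, Real.exp_add], fun x => ?_⟩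
  rw [← Real.exp_log (hw.pos x)]
  exact Real.exp_le_exp.2 (hlw x)

end Weight

end WeightedGroupAlgebra

namespace WeightedGroupAlgebra

open scoped CompactlySupported ENNReal

/-! ### The measure `w μ` and series of compactly supported functions. -/

section WeightedMeasure

/-- The measure `w μ`. -/
noncomputable abbrev weighted {G : Type*} [MeasurableSpace G] (μ : Measure G) (w : G → ℝ) :
    Measure G :=
  μ.withDensity fun x => ENNReal.ofReal (w x)

variable {G : Type*} [Group G] [MeasurableSpace G] {μ : Measure G} {w : G → ℝ}

theorem IsWeight.ae_weighted_iff (hw : IsWeight w) {P : G → Prop} :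
    (∀ᵐ x ∂weighted μ w, P x) ↔ ∀ᵐ x ∂μ, P x := by
  rw [ae_withDensity_iff hw.measurable.ennreal_ofReal]
  simp [hw.pos]

theorem IsWeight.integrable_weighted_iff (hw : IsWeight w) {g : G → ℂ} :
    Integrable g (weighted μ w) ↔ Integrable (fun x => w x • g x) μ := by
  rw [integrable_withDensity_iff_integrable_smul' hw.measurable.ennreal_ofReal (by simp)]
  simp [ENNReal.toReal_ofReal (hw.pos _).le]

theorem IsWeight.integral_weighted (hw : IsWeight w) {E : Type*} [NormedAddCommGroup E]
    [NormedSpace ℝ E] (g : G → E) : ∫ x, g x ∂weighted μ w = ∫ x, w x • g x ∂μ := by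
  rw [integral_withDensity_eq_integral_toReal_smul hw.measurable.ennreal_ofReal (by simp)]
  simp [ENNReal.toReal_ofReal (hw.pos _).le]

theorem IsWeight.lintegral_weighted (hw : IsWeight w) (g : G → ℝ≥0∞) :
    ∫⁻ x, g x ∂weighted μ w = ∫⁻ x, ENNReal.ofReal (w x) * g x ∂μ :=
  lintegral_withDensity_eq_lintegral_mul_non_measurable μ hw.measurable.ennreal_ofReal (by simp) g

end WeightedMeasure

section CompactlySupported

variable {X : Type*} [TopologicalSpace X] [MeasurableSpace X] [OpensMeasurableSpace X]
  (ν : Measure X) [IsFiniteMeasureOnCompacts ν]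

theorem memLp_cc (u : C_c(X, ℂ)) : MemLp u 1 ν :=
  u.continuous.memLp_of_hasCompactSupport u.hasCompactSupport

/-- The class in `L¹` of a continuous function with compact support. -/
noncomputable def ofCc : C_c(X, ℂ) →ₗ[ℂ] Lp ℂ 1 ν where
  toFun u := (memLp_cc ν u).toLp
  map_add' _ _ := rfl
  map_smul' _ _ := rfl

theorem coeFn_ofCc (u : C_c(X, ℂ)) : ⇑(ofCc ν u) =ᵐ[ν] u := (memLp_cc ν u).coeFn_toLp

theorem enorm_ofCc (u : C_c(X, ℂ)) : ‖ofCc ν u‖ₑ = ∫⁻ x, ‖u x‖ₑ ∂ν := by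
  rw [Lp.enorm_def, eLpNorm_congr_ae (coeFn_ofCc ν u), eLpNorm_one_eq_lintegral_enorm]

/-- Absolutely convergent expansions in `C_c` allow convolutions in `L¹(G, w)` to be computed term
by term. -/
theorem exists_hasSum_ofCc {ν : Measure X} [IsFiniteMeasureOnCompacts ν]
    (h : DenseRange (ofCc ν)) (f : Lp ℂ 1 ν) :
    ∃ u : ℕ → C_c(X, ℂ), Summable (fun n => ‖ofCc ν (u n)‖) ∧ HasSum (fun n => ofCc ν (u n)) f := by
  obtain ⟨v, hv, hm, -, hb⟩ := controlled_sum_of_mem_closure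
    (s := (ofCc ν).toAddMonoidHom.range) (a := f) (h f) (b := fun n => (1 / 2) ^ n)
    (fun n => by positivity)
  choose u hu using hm
  have hu' : ∀ n, ofCc ν (u n) = v n := hu
  have hs : Summable fun n => ‖ofCc ν (u n)‖ := by
    simp_rw [hu']
    -- The term of index 0 carries no norm bound, hence the shift.
    refine (summable_nat_add_iff 1).1 ?_
    refine Summable.of_nonneg_of_le (fun _ => norm_nonneg _)
      (fun n => (hb (n + 1) n.succ_pos).le) ?_
    exact (summable_nat_add_iff 1).2 (summable_geometric_of_lt_one (by norm_num) (by norm_num))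
  refine ⟨u, hs, ?_⟩
  have h1 := hs.of_norm.hasSum
  have h2 := (Filter.tendsto_add_atTop_iff_nat 1).2 h1.tendsto_sum_nat
  simp_rw [hu'] at h1 h2 ⊢
  rwa [tendsto_nhds_unique h2 hv] at h1

theorem tsum_enorm_ne_top_of_summable_norm {ι E : Type*} [SeminormedAddCommGroup E] {f : ι → E}
    (h : Summable fun i => ‖f i‖) : ∑' i, ‖f i‖ₑ ≠ ∞ :=
  tsum_enorm_ne_top_iff_summable_norm.2 h

theorem ae_hasSum_of_hasSum {ν : Measure X} [IsFiniteMeasureOnCompacts ν] {ι : Type*} [Countable ι]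
    {u : ι → C_c(X, ℂ)} {f : Lp ℂ 1 ν} (hs : Summable fun i => ‖ofCc ν (u i)‖)
    (hf : HasSum (fun i => ofCc ν (u i)) f) :
    ∀ᵐ x ∂ν, Summable (fun i => ‖u i x‖) ∧ HasSum (fun i => u i x) (f x) := by
  have h1 := Lp.hasSum_coeFn_tsum (tsum_enorm_ne_top_of_summable_norm hs)
  have h2 := summable_norm_of_tsum_eLpNorm_ne_top (le_refl 1)
    (fun i => Lp.aestronglyMeasurable (ofCc ν (u i)))
    (by simpa only [Lp.enorm_def] using tsum_enorm_ne_top_of_summable_norm hs)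
  have h3 : ∀ᵐ x ∂ν, ∀ i, ofCc ν (u i) x = u i x := ae_all_iff.2 fun i => coeFn_ofCc ν (u i)
  rw [hf.tsum_eq] at h1
  filter_upwards [h1, h2, h3] with x h1 h2 h3
  simp_rw [h3] at h1 h2
  exact ⟨h2, h1⟩

end CompactlySupported

/-! ### Density of `C_c` in `L¹(μ)` and in `L¹(G, w)`. -/

section Density

/-- Continuous functions with compact support are dense in `L¹` of a regular measure. -/
theorem exists_hasCompactSupport_integral_norm_sub_le {X : Type*} [TopologicalSpace X] [T2Space X]
    [LocallyCompactSpace X] [MeasurableSpace X] [BorelSpace X] {μ : Measure X} [μ.Regular]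
    {f : X → ℂ} (hf : Integrable f μ) {ε : ℝ} (hε : 0 < ε) :
    ∃ g : X → ℂ, HasCompactSupport g ∧ ∫ x, ‖f x - g x‖ ∂μ ≤ ε ∧ Continuous g ∧
      Integrable g μ := by
  obtain ⟨g, hg, hgc, hgs⟩ := (memLp_one_iff_integrable.2 hf).induction_dense ENNReal.one_ne_top
    (fun g : X → ℂ => Continuous g ∧ HasCompactSupport g)
    (fun c s hs hμs ε hε => by
      rcases eq_or_ne c 0 with rfl | hc
      · exact ⟨0, by simp, continuous_zero, HasCompactSupport.zero⟩
      -- A Urysohn function for `K ⊆ s ⊆ U` differs from the indicator of `s` only on `U \ K`; the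
      -- pieces `U \ s` and `s \ K` each cost at most `ε / 2`.
      set δ := ε / (2 * ‖c‖ₑ) with hδ
      have hδ0 : δ ≠ 0 := ENNReal.div_ne_zero.2 ⟨hε, by finiteness⟩
      obtain ⟨K, hKs, hK, hKd⟩ := hs.exists_isCompact_sdiff_lt hμs.ne hδ0
      obtain ⟨U, hsU, hU, -, hUd⟩ := hs.exists_isOpen_sdiff_lt hμs.ne hδ0
      obtain ⟨θ, hθ1, hθ0, hθc, hθI⟩ := exists_continuous_one_zero_of_isCompact hK
        hU.isClosed_compl (Set.disjoint_compl_right_iff_subset.2 (hKs.trans hsU))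
      refine ⟨fun x => (θ x : ℂ) * c, ?_, by fun_prop,
        (hθc.comp_left (g := fun r : ℝ => (r : ℂ)) (by simp)).mul_right⟩
      rw [eLpNorm_one_eq_lintegral_enorm]
      have hle : ∀ x, ‖((fun x => (θ x : ℂ) * c) - s.indicator fun _ => c) x‖ₑ ≤
          (U \ K).indicator (fun _ => ‖c‖ₑ) x := fun x => by
        have hn : ∀ r : ℝ, |r| ≤ 1 → ‖(r : ℂ) * c‖ₑ ≤ ‖c‖ₑ := fun r hr => by
          rw [enorm_le_iff_norm_le, norm_mul, Complex.norm_real, Real.norm_eq_abs]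
          exact mul_le_of_le_one_left (norm_nonneg c) hr
        have hI := hθI x
        simp only [Pi.sub_apply]
        by_cases hxK : x ∈ K
        · have : θ x = 1 := hθ1 hxK
          simp [this, hKs hxK]
        by_cases hxU : x ∈ U
        · rw [Set.indicator_of_mem (show x ∈ U \ K from ⟨hxU, hxK⟩)]
          by_cases hxs : x ∈ s
          · rw [Set.indicator_of_mem hxs,
              show (θ x : ℂ) * c - c = ((θ x - 1 : ℝ) : ℂ) * c by push_cast; ring]
            exact hn _ (abs_le.2 ⟨by linarith [hI.1], by linarith [hI.2]⟩)
          · rw [Set.indicator_of_notMem hxs, sub_zero]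
            exact hn _ (abs_le.2 ⟨by linarith [hI.1], by linarith [hI.2]⟩)
        · have : θ x = 0 := hθ0 hxU
          have hxs : x ∉ s := fun h => hxU (hsU h)
          simp [this, Set.indicator_of_notMem hxs]
      calc _ ≤ ∫⁻ x, (U \ K).indicator (fun _ => ‖c‖ₑ) x ∂μ := lintegral_mono hle
        _ = ‖c‖ₑ * μ (U \ K) := by
          rw [lintegral_indicator_const (hU.measurableSet.diff hK.measurableSet)]
        _ ≤ ‖c‖ₑ * (μ (U \ s) + μ (s \ K)) := by
          gcongr
          refine (measure_mono fun x hx => ?_).trans (measure_union_le _ _)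
          by_cases hxs : x ∈ s
          · exact Or.inr ⟨hxs, hx.2⟩
          · exact Or.inl ⟨hx.1, hxs⟩
        _ ≤ ‖c‖ₑ * (δ + δ) := by gcongr
        _ = ε := by
          have h0 : ‖c‖ₑ ≠ 0 := by simpa using hc
          rw [hδ, ← two_mul, ← mul_assoc, mul_comm ‖c‖ₑ 2]
          exact ENNReal.mul_div_cancel (by simp [h0]) (by finiteness))
    (fun f g hf hg => ⟨hf.1.add hg.1, hf.2.add hg.2⟩)
    (fun f hf => (hf.1.memLp_of_hasCompactSupport (p := 1) hf.2).aestronglyMeasurable)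
    (ENNReal.ofReal_pos.2 hε).ne'
  have hgi : Integrable g μ := hgc.integrable_of_hasCompactSupport hgs
  refine ⟨g, hgs, ?_, hgc, hgi⟩
  rw [eLpNorm_one_eq_lintegral_enorm] at hg
  change ∫ x, ‖(f - g) x‖ ∂μ ≤ ε
  rw [integral_norm_eq_lintegral_enorm (hf.sub hgi).aestronglyMeasurable]
  exact ENNReal.toReal_le_of_le_ofReal hε.le hg

theorem IsWeight.isOpenPosMeasure_weighted {G : Type*} [CommGroup G] [TopologicalSpace G]
    [MeasurableSpace G] [OpensMeasurableSpace G] (μ : Measure G) [μ.IsOpenPosMeasure] {w : G → ℝ}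
    (hw : IsWeight w) :
    (weighted μ w).IsOpenPosMeasure where
  open_pos U hU hne h0 := by
    refine hU.measure_ne_zero μ hne ?_
    have : ∀ᵐ x ∂weighted μ w, x ∉ U := by rwa [ae_iff, show {a | ¬ a ∉ U} = U by ext; simp]
    rw [hw.ae_weighted_iff, ae_iff] at this
    rwa [show {a | ¬ a ∉ U} = U by ext; simp] at this

variable {G : Type*} [CommGroup G] [TopologicalSpace G] [IsTopologicalGroup G]
    [LocallyCompactSpace G] [T2Space G] [MeasurableSpace G] [BorelSpace G]
    (μ : Measure G) [μ.IsHaarMeasure] [μ.Regular] {w : G → ℝ}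

theorem IsWeight.isFiniteMeasureOnCompacts_weighted (hw : IsWeight w) :
    IsFiniteMeasureOnCompacts (weighted μ w) where
  lt_top_of_isCompact K hK := by
    obtain ⟨C, -, hC⟩ := hw.exists_forall_mem_le μ hK
    rw [withDensity_apply _ hK.measurableSet]
    calc _ ≤ ∫⁻ _ in K, ENNReal.ofReal C ∂μ :=
          setLIntegral_mono measurable_const fun x hx => ENNReal.ofReal_le_ofReal (hC x hx)
      _ < ⊤ := by
        rw [setLIntegral_const]
        exact ENNReal.mul_lt_top ENNReal.ofReal_lt_top hK.measure_lt_top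

/-- As `w` is only measurable, the approximation is made twice in `L¹(μ)`: of `w f` by a compactly
supported `p`, then of `w⁻¹ p` by `q`. A cutoff `θ` confines the second error to a compact set where
`w` is bounded. -/
theorem IsWeight.denseRange_ofCc (hw : IsWeight w) [IsFiniteMeasureOnCompacts (weighted μ w)] :
    DenseRange (ofCc (weighted μ w)) := by
  rw [Metric.denseRange_iff]
  intro f ε hε
  have hfi : Integrable (fun x => w x • f x) μ :=
    hw.integrable_weighted_iff.1 (L1.integrable_coeFn f)
  obtain ⟨p, hpc, hp, hpcont, hpi⟩ := exists_hasCompactSupport_integral_norm_sub_le hfi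
    (ε := ε / 3) (by positivity)
  obtain ⟨c, hc, hcK⟩ := hw.exists_forall_mem_ge μ hpc.isCompact
  obtain ⟨θ, hθ1, -, hθc, hθI⟩ := exists_continuous_one_zero_of_isCompact hpc.isCompact
    isClosed_empty (Set.disjoint_empty _)
  obtain ⟨M, hM, hMK⟩ := hw.exists_forall_mem_le μ hθc.isCompact
  have hp0 : ∀ x, x ∉ tsupport p → p x = 0 := fun x hx => image_eq_zero_of_notMem_tsupport hx
  have hri : Integrable (fun x => (w x)⁻¹ • p x) μ := by
    refine (hpi.norm.const_mul c⁻¹).mono' ?_ (Filter.Eventually.of_forall fun x => ?_)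
    · exact (hw.measurable.inv.aestronglyMeasurable).smul hpi.aestronglyMeasurable
    · rw [norm_smul, norm_inv, Real.norm_of_nonneg (hw.pos x).le]
      by_cases hx : x ∈ tsupport p
      · gcongr
        exact hcK x hx
      · simp [hp0 x hx]
  obtain ⟨q, hqc, hq, hqcont, hqi⟩ := exists_hasCompactSupport_integral_norm_sub_le hri
    (ε := ε / (3 * M)) (by positivity)
  let u : C_c(G, ℂ) := ⟨⟨fun x => (θ x : ℂ) * q x, by fun_prop⟩, hqc.mul_left⟩
  have hu : ∀ x, u x = (θ x : ℂ) * q x := fun x => rfl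
  refine ⟨u, ?_⟩
  rw [dist_eq_norm, L1.norm_eq_integral_norm, hw.integral_weighted]
  have hae : (fun x => w x • ‖(f - ofCc (weighted μ w) u) x‖) =ᵐ[μ]
      fun x => w x • ‖f x - u x‖ := by
    have h1 := hw.ae_weighted_iff.1 (Lp.coeFn_sub f (ofCc (weighted μ w) u))
    have h2 := hw.ae_weighted_iff.1 (coeFn_ofCc (weighted μ w) u)
    filter_upwards [h1, h2] with x h1 h2
    rw [h1, Pi.sub_apply, h2]
  rw [integral_congr_ae hae]
  have hle : ∀ x, w x • ‖f x - u x‖ ≤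
      ‖w x • f x - p x‖ + M * ‖(w x)⁻¹ • p x - q x‖ := fun x => by
    have hwx := hw.pos x
    have e1 : w x • ‖f x - u x‖ = ‖w x • f x - w x • u x‖ := by
      rw [← smul_sub, norm_smul, Real.norm_of_nonneg hwx.le, smul_eq_mul]
    have e2 : ‖p x - w x • u x‖ ≤ M * ‖(w x)⁻¹ • p x - q x‖ := by
      -- Uses `θ = 1` on the support of `p`.
      have e3 : p x - w x • u x = (w x * θ x) • ((w x)⁻¹ • p x - q x) := by
        by_cases hx : x ∈ tsupport p
        · have : θ x = 1 := hθ1 hx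
          rw [hu, this, smul_sub, mul_one, smul_inv_smul₀ hwx.ne']
          simp
        · rw [hp0 x hx, hu]
          simp [mul_assoc]
      rw [e3, norm_smul]
      gcongr
      rw [norm_mul, Real.norm_of_nonneg hwx.le, Real.norm_of_nonneg (hθI x).1]
      by_cases hx : x ∈ tsupport θ
      · exact (mul_le_of_le_one_right hwx.le (hθI x).2).trans (hMK x hx)
      · rw [image_eq_zero_of_notMem_tsupport hx, mul_zero]
        exact hM.le
    rw [e1]
    calc _ = ‖(w x • f x - p x) + (p x - w x • u x)‖ := by congr 1; ring
      _ ≤ _ := (norm_add_le _ _).trans (by gcongr)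
  have hi1 : Integrable (fun x => ‖w x • f x - p x‖) μ := (hfi.sub hpi).norm
  have hi2 : Integrable (fun x => M * ‖(w x)⁻¹ • p x - q x‖) μ := (hri.sub hqi).norm.const_mul M
  have hfin := integral_mono_of_nonneg (Filter.Eventually.of_forall fun x =>
    smul_nonneg (hw.pos x).le (norm_nonneg (f x - u x))) (hi1.add hi2)
    (Filter.Eventually.of_forall hle)
  simp only [Pi.add_apply] at hfin
  rw [integral_add hi1 hi2, integral_const_mul] at hfin
  have h4 : M * ∫ x, ‖(w x)⁻¹ • p x - q x‖ ∂μ ≤ ε / 3 := by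
    calc _ ≤ M * (ε / (3 * M)) := by gcongr
      _ = ε / 3 := by field_simp
  linarith

end Density

end WeightedGroupAlgebra

namespace WeightedGroupAlgebra

open scoped CompactlySupported ENNReal Pointwise

theorem tsum_enorm_mul_enorm_ne_top {ι κ E : Type*} [SeminormedAddCommGroup E]
    {f : ι → E} {g : κ → E} (hf : Summable fun i => ‖f i‖) (hg : Summable fun i => ‖g i‖) :
    ∑' p : ι × κ, ‖f p.1‖ₑ * ‖g p.2‖ₑ ≠ ∞ := by
  rw [ENNReal.tsum_prod (f := fun i j => ‖f i‖ₑ * ‖g j‖ₑ)]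
  simp_rw [ENNReal.tsum_mul_left, ENNReal.tsum_mul_right]
  exact ENNReal.mul_ne_top (tsum_enorm_ne_top_of_summable_norm hf)
    (tsum_enorm_ne_top_of_summable_norm hg)

theorem map_eq_mul_of_hasSum {E : Type*} [NormedAddCommGroup E] [NormedSpace ℂ E]
    (φ : E →L[ℂ] ℂ) {a b : ℕ → E} {c : ℕ × ℕ → E} {f g h : E}
    (ha : Summable fun n => ‖a n‖) (hb : Summable fun n => ‖b n‖) (hf : HasSum a f)
    (hg : HasSum b g) (hh : HasSum c h) (hc : ∀ p, φ (c p) = φ (a p.1) * φ (b p.2)) :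
    φ h = φ f * φ g := by
  have h1 := φ.hasSum hh
  simp_rw [hc] at h1
  have hn : ∀ {a : ℕ → E}, (Summable fun n => ‖a n‖) → Summable fun n => ‖φ (a n)‖ := fun hu =>
    Summable.of_nonneg_of_le (fun _ => norm_nonneg _) (fun n => φ.le_opNorm _) (hu.mul_left _)
  have h2 := summable_mul_of_summable_norm (hn ha) (hn hb)
  have h3 := HasSum.mul (φ.hasSum hf) (φ.hasSum hg) h2
  exact h1.unique h3

theorem lintegral_lintegral_mul_swap {X Y : Type*} [MeasurableSpace X] [MeasurableSpace Y]
    {ρ : Measure X} {σ : Measure Y} [SFinite ρ] [SFinite σ] {a : X → ℝ≥0∞} {k : Y × X → ℝ≥0∞}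
    (ha : Measurable a) (hk : Measurable k) :
    ∫⁻ x, ∫⁻ y, a x * k (y, x) ∂σ ∂ρ = ∫⁻ y, ∫⁻ x, a x * k (y, x) ∂ρ ∂σ :=
  lintegral_lintegral_swap
    ((ha.comp measurable_fst).mul (hk.comp measurable_swap)).aemeasurable

/-! ### Convolution on `C_c(G)` and its extension to `L¹(G, w)`. -/

section Convolution

variable {G : Type*} [CommGroup G] [TopologicalSpace G] [IsTopologicalGroup G]

theorem hasCompactSupport_mul_comp_inv_mul (u v : C_c(G, ℂ)) :
    HasCompactSupport (fun p : G × G => u p.1 * v (p.1⁻¹ * p.2)) := by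
  refine HasCompactSupport.intro' (K := (tsupport u) ×ˢ (closure (tsupport u * tsupport v)))
    (u.hasCompactSupport.isCompact.prod
      (u.hasCompactSupport.isCompact.mul v.hasCompactSupport.isCompact).closure)
    ((isClosed_tsupport u).prod isClosed_closure) fun p hp => ?_
  by_contra h
  refine hp ⟨subset_tsupport u (left_ne_zero_of_mul h), subset_closure ?_⟩
  exact ⟨p.1, subset_tsupport u (left_ne_zero_of_mul h), p.1⁻¹ * p.2,
    subset_tsupport v (right_ne_zero_of_mul h), by simp⟩

theorem continuous_mul_comp_inv_mul (u v : C_c(G, ℂ)) :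
    Continuous (fun p : G × G => u p.1 * v (p.1⁻¹ * p.2)) :=
  (u.continuous.comp continuous_fst).mul
    (v.continuous.comp (continuous_fst.inv.mul continuous_snd))

theorem mul_comp_inv_mul_eq_zero {G : Type*} [CommGroup G] [TopologicalSpace G] {u v : C_c(G, ℂ)} {x : G}
    (hx : x ∉ tsupport u * tsupport v) (y : G) : u y * v (y⁻¹ * x) = 0 := by
  by_contra h
  exact hx ⟨y, subset_tsupport u (left_ne_zero_of_mul h), y⁻¹ * x,
    subset_tsupport v (right_ne_zero_of_mul h), by simp⟩

variable [MeasurableSpace G] [BorelSpace G]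
    (μ : Measure G) [μ.IsHaarMeasure]

/-- The convolution of two continuous functions with compact support. -/
noncomputable def convCc (u v : C_c(G, ℂ)) : C_c(G, ℂ) where
  toFun := conv μ u v
  continuous_toFun := by
    rw [← continuousOn_univ]
    refine continuousOn_integral_of_compact_support (k := tsupport u)
      u.hasCompactSupport.isCompact ?_ fun x y _ hy => ?_
    · exact ((continuous_mul_comp_inv_mul u v).comp continuous_swap).continuousOn
    · rw [image_eq_zero_of_notMem_tsupport hy, zero_mul]
  hasCompactSupport' := HasCompactSupport.intro
    (u.hasCompactSupport.isCompact.mul v.hasCompactSupport.isCompact) fun x hx => by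
      simp [conv, mul_comp_inv_mul_eq_zero hx]

@[simp]
theorem coe_convCc (u v : C_c(G, ℂ)) : ⇑(convCc μ u v) = conv μ u v := rfl

theorem integrable_mul_comp_inv_mul (u v : C_c(G, ℂ)) (x : G) :
    Integrable (fun y => u y * v (y⁻¹ * x)) μ :=
  Continuous.integrable_of_hasCompactSupport
    (u.continuous.mul (v.continuous.comp (continuous_inv.mul continuous_const))) u.hasCompactSupport.mul_right

/-- Without σ-finiteness, measurability in the parameter is obtained from continuity of the
integral. -/
theorem measurable_lintegral_mul_comp_inv_mul (u v : C_c(G, ℂ)) :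
    Measurable fun x => ∫⁻ y, ‖u y * v (y⁻¹ * x)‖ₑ ∂μ := by
  have : (fun x => ∫⁻ y, ‖u y * v (y⁻¹ * x)‖ₑ ∂μ) =
      fun x => ENNReal.ofReal (∫ y, ‖u y * v (y⁻¹ * x)‖ ∂μ) := funext fun x =>
    (ofReal_integral_norm_eq_lintegral_enorm (integrable_mul_comp_inv_mul μ u v x)).symm
  rw [this]
  refine Continuous.measurable ?_ |>.ennreal_ofReal
  rw [← continuousOn_univ]
  refine continuousOn_integral_of_compact_support (k := tsupport u)
    u.hasCompactSupport.isCompact ?_ fun x y _ hy => ?_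
  · exact ((continuous_mul_comp_inv_mul u v).comp continuous_swap).norm.continuousOn
  · rw [image_eq_zero_of_notMem_tsupport hy, zero_mul, norm_zero]

/-- Fubini for a continuous compactly supported kernel, then translation invariance. With `c` a
matrix coefficient, it makes integrated representations multiplicative. -/
theorem integral_conv_mul (u v : C_c(G, ℂ)) {c : G → ℂ} (hc : Continuous c) :
    ∫ x, conv μ u v x * c x ∂μ = ∫ y, u y * ∫ x, v x * c (y * x) ∂μ ∂μ := by
  simp_rw [conv, ← integral_mul_const]
  rw [integral_integral_swap_of_hasCompactSupport]
  · refine integral_congr_ae (Filter.Eventually.of_forall fun y => ?_)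
    beta_reduce
    rw [← integral_const_mul, ← integral_mul_left_eq_self _ y]
    simp [mul_assoc]
  · exact ((continuous_mul_comp_inv_mul u v).comp continuous_swap).mul (hc.comp continuous_fst)
  · have := ((hasCompactSupport_mul_comp_inv_mul u v).mul_right (f' := fun p => c p.2)).comp_homeomorph
      (Homeomorph.prodComm G G)
    exact this

variable {w : G → ℝ}

/-- Tonelli, translation invariance and submultiplicativity of `w`. Restricting to the compact
supports makes the measures finite, so Tonelli applies; bounding the integral of absolute values
also yields the absolute convergence used for series. -/
theorem IsWeight.lintegral_conv_le (hw : IsWeight w) [IsFiniteMeasureOnCompacts (weighted μ w)]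
    (u v : C_c(G, ℂ)) :
    ∫⁻ x, ∫⁻ y, ‖u y * v (y⁻¹ * x)‖ₑ ∂μ ∂weighted μ w ≤
      ‖ofCc (weighted μ w) u‖ₑ * ‖ofCc (weighted μ w) v‖ₑ := by
  simp_rw [enorm_ofCc, hw.lintegral_weighted]
  set A := tsupport u
  set S := tsupport u * tsupport v
  have hA : IsCompact A := u.hasCompactSupport.isCompact
  have hS : IsCompact S := hA.mul v.hasCompactSupport.isCompact
  have : IsFiniteMeasure (μ.restrict A) := ⟨by simpa using hA.measure_lt_top⟩
  have : IsFiniteMeasure (μ.restrict S) := ⟨by simpa using hS.measure_lt_top⟩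
  -- The Borel σ-algebra of `G × G` may exceed the product one; compact support gives measurability
  -- for the latter.
  have hmeas : Measurable fun p : G × G => ‖u p.1 * v (p.1⁻¹ * p.2)‖ₑ :=
    ((hasCompactSupport_mul_comp_inv_mul u v).measurable_of_prod
      (continuous_mul_comp_inv_mul u v)).enorm
  have hswap := lintegral_lintegral_mul_swap (ρ := μ.restrict S) (σ := μ.restrict A)
    hw.measurable.ennreal_ofReal hmeas
  calc ∫⁻ x, ENNReal.ofReal (w x) * ∫⁻ y, ‖u y * v (y⁻¹ * x)‖ₑ ∂μ ∂μ
      = ∫⁻ x in S, ∫⁻ y in A, ENNReal.ofReal (w x) * ‖u y * v (y⁻¹ * x)‖ₑ ∂μ ∂μ := by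
        rw [← setLIntegral_eq_of_support_subset (s := S)]
        · refine lintegral_congr fun x => ?_
          rw [← lintegral_const_mul' _ _ ENNReal.ofReal_ne_top, ← setLIntegral_eq_of_support_subset]
          intro y hy
          by_contra hyA
          simp [image_eq_zero_of_notMem_tsupport hyA] at hy
        · intro x hx
          by_contra hxS
          refine hx ?_
          simp_rw [mul_comp_inv_mul_eq_zero hxS]
          simp
    _ = ∫⁻ y in A, ∫⁻ x in S, ENNReal.ofReal (w x) * ‖u y * v (y⁻¹ * x)‖ₑ ∂μ ∂μ :=
        hswap
    _ ≤ ∫⁻ y, ∫⁻ x, ENNReal.ofReal (w x) * ‖u y * v (y⁻¹ * x)‖ₑ ∂μ ∂μ :=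
        (setLIntegral_le_lintegral _ _).trans
          (lintegral_mono fun y => setLIntegral_le_lintegral _ _)
    _ ≤ ∫⁻ y, ENNReal.ofReal (w y) * ‖u y‖ₑ * ∫⁻ x, ENNReal.ofReal (w x) * ‖v x‖ₑ ∂μ ∂μ := by
        refine lintegral_mono fun y => ?_
        rw [← lintegral_mul_left_eq_self _ y, ← lintegral_const_mul' _ _ (by finiteness)]
        refine lintegral_mono fun x => ?_
        rw [inv_mul_cancel_left, enorm_mul]
        calc _ ≤ ENNReal.ofReal (w y * w x) * (‖u y‖ₑ * ‖v x‖ₑ) := by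
              gcongr
              exact hw.submultiplicative y x
          _ = _ := by
              rw [ENNReal.ofReal_mul (hw.pos y).le]
              ring
    _ = _ := by
        rw [lintegral_mul_const]
        exact hw.measurable.ennreal_ofReal.mul u.continuous.measurable.enorm

theorem IsWeight.norm_ofCc_convCc_le (hw : IsWeight w) [IsFiniteMeasureOnCompacts (weighted μ w)]
    (u v : C_c(G, ℂ)) : ‖ofCc (weighted μ w) (convCc μ u v)‖ ≤
      ‖ofCc (weighted μ w) u‖ * ‖ofCc (weighted μ w) v‖ := by
  have : ‖ofCc (weighted μ w) (convCc μ u v)‖ₑ ≤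
      ‖ofCc (weighted μ w) u‖ₑ * ‖ofCc (weighted μ w) v‖ₑ := by
    refine le_trans ?_ (hw.lintegral_conv_le μ u v)
    rw [enorm_ofCc]
    exact lintegral_mono fun x => enorm_integral_le_lintegral_enorm _
  rwa [← ofReal_norm, ← ofReal_norm, ← ofReal_norm, ← ENNReal.ofReal_mul (norm_nonneg _),
    ENNReal.ofReal_le_ofReal_iff (by positivity)] at this

variable [μ.Regular] [LocallyCompactSpace G]

/-- Convolution in `L¹(G, w)`, expressed through series of continuous functions with compact
support. -/
theorem IsWeight.exists_hasSum_conv (hw : IsWeight w) [IsFiniteMeasureOnCompacts (weighted μ w)]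
    {u v : ℕ → C_c(G, ℂ)} {f g : L1w μ w}
    (hu : Summable fun n => ‖ofCc (weighted μ w) (u n)‖)
    (hv : Summable fun n => ‖ofCc (weighted μ w) (v n)‖)
    (hf : HasSum (fun n => ofCc (weighted μ w) (u n)) f)
    (hg : HasSum (fun n => ofCc (weighted μ w) (v n)) g) :
    ∃ h : L1w μ w, HasSum (fun p : ℕ × ℕ => ofCc (weighted μ w) (convCc μ (u p.1) (v p.2))) h ∧
      ⇑h =ᵐ[μ] conv μ f g := by
  have hprod := hu.mul_of_nonneg hv (fun _ => norm_nonneg _) fun _ => norm_nonneg _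
  have hs : Summable fun p : ℕ × ℕ => ‖ofCc (weighted μ w) (convCc μ (u p.1) (v p.2))‖ :=
    Summable.of_nonneg_of_le (fun _ => norm_nonneg _) (fun p => hw.norm_ofCc_convCc_le μ _ _) hprod
  have hsum := hs.of_norm.hasSum
  refine ⟨_, hsum, ?_⟩
  have hae := hw.ae_weighted_iff.1 (ae_hasSum_of_hasSum hs hsum)
  have haef := hw.ae_weighted_iff.1 (ae_hasSum_of_hasSum hu hf)
  have haeg := hw.ae_weighted_iff.1 (ae_hasSum_of_hasSum hv hg)
  -- For almost every `x` the double series is absolutely integrable in `y`, which allows the sum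
  -- and the integral to be exchanged.
  have hfin : ∀ᵐ x ∂μ, ∑' p : ℕ × ℕ, ∫⁻ y, ‖u p.1 y * v p.2 (y⁻¹ * x)‖ₑ ∂μ < ⊤ := by
    rw [← hw.ae_weighted_iff]
    have hm : ∀ p : ℕ × ℕ, Measurable fun x => ∫⁻ y, ‖u p.1 y * v p.2 (y⁻¹ * x)‖ₑ ∂μ := fun p =>
      measurable_lintegral_mul_comp_inv_mul μ (u p.1) (v p.2)
    refine ae_lt_top (Measurable.tsum hm) ?_
    have heq := lintegral_tsum (μ := weighted μ w) fun p => (hm p).aemeasurable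
    rw [heq]
    have hle : ∑' p : ℕ × ℕ, ∫⁻ x, ∫⁻ y, ‖u p.1 y * v p.2 (y⁻¹ * x)‖ₑ ∂μ ∂weighted μ w ≤
        ∑' p : ℕ × ℕ, ‖ofCc (weighted μ w) (u p.1)‖ₑ * ‖ofCc (weighted μ w) (v p.2)‖ₑ :=
      ENNReal.tsum_le_tsum fun p => hw.lintegral_conv_le μ (u p.1) (v p.2)
    exact ne_top_of_le_ne_top (tsum_enorm_mul_enorm_ne_top hu hv) hle
  filter_upwards [hae, hfin] with x hx hxfin
  -- The expansion of `g` can be evaluated at `y⁻¹ * x` for almost every `y`, since this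
  -- substitution preserves `μ`.
  have hq : Measure.QuasiMeasurePreserving (fun y : G => y⁻¹ * x) μ μ :=
    ((measurePreserving_mul_right μ x).comp (Measure.measurePreserving_inv μ)).quasiMeasurePreserving
  have hy : (fun y => f y * g (y⁻¹ * x)) =ᵐ[μ]
      fun y => ∑' p : ℕ × ℕ, u p.1 y * v p.2 (y⁻¹ * x) := by
    filter_upwards [haef, hq.ae haeg] with y h1 h2
    have h3 := summable_mul_of_summable_norm h1.1 h2.1
    have h4 := HasSum.mul h1.2 h2.2 h3
    exact h4.tsum_eq.symm
  have hm : ∀ p : ℕ × ℕ, AEStronglyMeasurable (fun y => u p.1 y * v p.2 (y⁻¹ * x)) μ := fun p =>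
    (integrable_mul_comp_inv_mul μ (u p.1) (v p.2) x).aestronglyMeasurable
  have h5 := integral_tsum hm hxfin.ne
  exact hx.2.tsum_eq.symm.trans (h5.symm.trans (integral_congr_ae hy).symm)

/-- Expand `f` and `g` in `C_c`-series; continuity of `φ` turns the double series of convolutions
into a Cauchy product. -/
theorem IsWeight.map_eq_mul_of_forall_cc [T2Space G] (hw : IsWeight w)
    [IsFiniteMeasureOnCompacts (weighted μ w)] (φ : L1w μ w →L[ℂ] ℂ)
    (hφ : ∀ u v : C_c(G, ℂ), φ (ofCc (weighted μ w) (convCc μ u v)) =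
      φ (ofCc (weighted μ w) u) * φ (ofCc (weighted μ w) v))
    (f g h : L1w μ w) (hh : ⇑h =ᵐ[μ] conv μ f g) : φ h = φ f * φ g := by
  obtain ⟨u, hu, hf⟩ := exists_hasSum_ofCc (hw.denseRange_ofCc μ) f
  obtain ⟨v, hv, hg⟩ := exists_hasSum_ofCc (hw.denseRange_ofCc μ) g
  obtain ⟨h', hh', hae⟩ := hw.exists_hasSum_conv μ hu hv hf hg
  have : h = h' := Lp.ext (hw.ae_weighted_iff.2 (hh.trans hae.symm))
  rw [this]
  exact map_eq_mul_of_hasSum φ hu hv hf hg hh' fun p => hφ _ _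

end Convolution

end WeightedGroupAlgebra

namespace WeightedGroupAlgebra

/-! ### Commutative C⋆-algebras and integrated representations. -/

set_option linter.unusedSectionVars false

open scoped CompactlySupported ENNReal

open scoped IsMulCommutative in
/-- The characters of a commutative C⋆-algebra separate its points. -/
theorem exists_multiplicative_functional_ne_zero {A : Type*} [CStarAlgebra A] (s : Set A)
    (hcomm : ∀ a ∈ s, ∀ b ∈ s, a * b = b * a) (hstar : ∀ a ∈ s, ∀ b ∈ s, a * star b = star b * a)
    {a : A} (ha : a ∈ s) (ha0 : a ≠ 0) :
    ∃ (B : StarSubalgebra ℂ A) (hB : s ⊆ B) (ψ : B →L[ℂ] ℂ),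
      (∀ x y, ψ (x * y) = ψ x * ψ y) ∧ ψ ⟨a, hB ha⟩ ≠ 0 := by
  let B := (StarAlgebra.adjoin ℂ s).topologicalClosure
  have hB : s ⊆ B := (StarAlgebra.subset_adjoin ℂ s).trans
    (StarSubalgebra.le_topologicalClosure (StarAlgebra.adjoin ℂ s))
  have := StarAlgebra.isMulCommutative_adjoin ℂ hcomm hstar
  have hcl : IsClosed (B : Set A) := StarSubalgebra.isClosed_topologicalClosure _
  let : CommRing B := StarSubalgebra.commRingTopologicalClosure (StarAlgebra.adjoin ℂ s) mul_comm
  let : CommCStarAlgebra B :=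
    { (inferInstance : CStarAlgebra B) with mul_comm := mul_comm }
  -- The closed star subalgebra generated by `s` is commutative, so its Gelfand transform is
  -- isometric.
  have hne : WeakDual.gelfandTransform ℂ B ⟨a, hB ha⟩ ≠ 0 := fun h => by
    have := (gelfandTransform_isometry B).injective (h.trans (map_zero _).symm)
    exact ha0 (congrArg Subtype.val this)
  obtain ⟨ψ, hψ⟩ := DFunLike.ne_iff.1 hne
  exact ⟨B, hB, WeakDual.CharacterSpace.toCLM ψ, fun x y => map_mul ψ x y, hψ⟩

section Integrated

variable {G : Type*} [CommGroup G] [TopologicalSpace G] [MeasurableSpace G] [BorelSpace G]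
  {μ : Measure G} {w : G → ℝ} {H : Type*} [NormedAddCommGroup H] [InnerProductSpace ℂ H]
  [CompleteSpace H]

/-- A strongly continuous representation of `G` dominated by the weight `w`. -/
structure IsDominatedRep (w : G → ℝ) (σ : G → H →L[ℂ] H) : Prop where
  rep_mul : ∀ x y, σ (x * y) = σ x * σ y
  continuous_apply : ∀ v, Continuous fun x => σ x v
  norm_apply_le : ∀ x v, ‖σ x v‖ ≤ w x * ‖v‖
  adjoint_mul : ∀ x y, star (σ x) * σ y = σ y * star (σ x)

variable {σ : G → H →L[ℂ] H}

namespace IsDominatedRep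

theorem continuous_coeff (hσ : IsDominatedRep w σ) (u v : H) :
    Continuous fun x => inner ℂ u (σ x v) := continuous_const.inner (hσ.continuous_apply v)

theorem norm_mul_coeff_le (hσ : IsDominatedRep w σ) (z : ℂ) (u v : H) (x : G) :
    ‖z * inner ℂ u (σ x v)‖ ≤ w x * ‖z‖ * (‖u‖ * ‖v‖) := by
  rw [norm_mul]
  calc ‖z‖ * ‖inner ℂ u (σ x v)‖ ≤ ‖z‖ * (‖u‖ * (w x * ‖v‖)) := by
        gcongr
        exact (norm_inner_le_norm _ _).trans (by gcongr; exact hσ.norm_apply_le x v)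
    _ = _ := by ring

theorem integrable_mul_coeff (hσ : IsDominatedRep w σ) (hw : IsWeight w) (f : L1w μ w) (u v : H) :
    Integrable (fun x => f x * inner ℂ u (σ x v)) μ := by
  have h1 : Integrable (fun x => w x • f x) μ :=
    hw.integrable_weighted_iff.1 (L1.integrable_coeFn f)
  refine (h1.norm.mul_const (‖u‖ * ‖v‖)).mono' ?_ (Filter.Eventually.of_forall fun x => ?_)
  · refine AEStronglyMeasurable.mul ?_ (hσ.continuous_coeff u v).measurable.aestronglyMeasurable
    obtain ⟨g, hg, hfg⟩ := Lp.aestronglyMeasurable f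
    exact ⟨g, hg, hw.ae_weighted_iff.1 hfg⟩
  · rw [norm_smul, Real.norm_of_nonneg (hw.pos x).le]
    exact hσ.norm_mul_coeff_le (f x) u v x

theorem norm_integral_mul_coeff_le (hσ : IsDominatedRep w σ) (hw : IsWeight w) (f : L1w μ w)
    (u v : H) : ‖∫ x, f x * inner ℂ u (σ x v) ∂μ‖ ≤ ‖f‖ * ‖u‖ * ‖v‖ := by
  have h1 : Integrable (fun x => w x • f x) μ :=
    hw.integrable_weighted_iff.1 (L1.integrable_coeFn f)
  have h2 : ‖f‖ = ∫ x, ‖w x • f x‖ ∂μ := by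
    rw [L1.norm_eq_integral_norm, hw.integral_weighted]
    refine integral_congr_ae (Filter.Eventually.of_forall fun x => ?_)
    simp [abs_of_pos (hw.pos x)]
  rw [h2, mul_assoc, ← integral_mul_const]
  refine norm_integral_le_of_norm_le (h1.norm.mul_const _) (Filter.Eventually.of_forall fun x => ?_)
  rw [norm_smul, Real.norm_of_nonneg (hw.pos x).le]
  exact hσ.norm_mul_coeff_le (f x) u v x

theorem exists_operator (hσ : IsDominatedRep w σ) (hw : IsWeight w) (f : L1w μ w) :
    ∃ T : H →L[ℂ] H, ∀ u v, inner ℂ u (T v) = ∫ x, f x * inner ℂ u (σ x v) ∂μ := by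
  have hi := hσ.integrable_mul_coeff hw f
  -- The operator is a weak integral, obtained from a bounded sesquilinear form by Riesz
  -- representation. The conjugate makes the form antilinear in `v` and linear in `u`, as that
  -- correspondence requires.
  let B : H →ₗ⋆[ℂ] H →ₗ[ℂ] ℂ := LinearMap.mk₂'ₛₗ (starRingEnd ℂ) (RingHom.id ℂ)
    (fun v u => conj (∫ x, f x * inner ℂ u (σ x v) ∂μ))
    (fun v v' u => by
      rw [← map_add, ← integral_add (hi u v) (hi u v')]
      simp [mul_add])
    (fun c v u => by
      rw [smul_eq_mul, ← map_mul, ← integral_const_mul]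
      simp [mul_left_comm])
    (fun v u u' => by
      rw [← map_add, ← integral_add (hi u v) (hi u' v)]
      simp [mul_add])
    (fun c v u => by
      rw [RingHom.id_apply, smul_eq_mul, ← Complex.conj_conj c, ← map_mul, ← integral_const_mul]
      simp [mul_comm, mul_assoc])
  let B' := B.mkContinuous₂ ‖f‖ fun v u => by
    change ‖conj (∫ x, f x * inner ℂ u (σ x v) ∂μ)‖ ≤ _
    rw [RCLike.norm_conj, mul_right_comm]
    exact hσ.norm_integral_mul_coeff_le hw f u v
  refine ⟨InnerProductSpace.continuousLinearMapOfBilin B', fun u v => ?_⟩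
  rw [← inner_conj_symm, InnerProductSpace.continuousLinearMapOfBilin_apply]
  change conj (conj (∫ x, f x * inner ℂ u (σ x v) ∂μ)) = _
  rw [Complex.conj_conj]

/-- The integrated form of a dominated representation. -/
theorem exists_integrated (hσ : IsDominatedRep w σ) (hw : IsWeight w) :
    ∃ L : L1w μ w →L[ℂ] H →L[ℂ] H,
      ∀ f u v, inner ℂ u (L f v) = ∫ x, f x * inner ℂ u (σ x v) ∂μ := by
  choose T hT using hσ.exists_operator (μ := μ) hw
  have hi := hσ.integrable_mul_coeff (μ := μ) hw
  let L : L1w μ w →ₗ[ℂ] H →L[ℂ] H :=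
    { toFun := T
      map_add' := fun f g => by
        ext v
        refine ext_inner_left ℂ fun u => ?_
        rw [add_apply, inner_add_right, hT, hT, hT,
          ← integral_add (hi f u v) (hi g u v)]
        refine integral_congr_ae ?_
        filter_upwards [hw.ae_weighted_iff.1 (Lp.coeFn_add f g)] with x hx
        rw [hx, Pi.add_apply, add_mul]
      map_smul' := fun c f => by
        ext v
        refine ext_inner_left ℂ fun u => ?_
        rw [RingHom.id_apply, smul_apply, inner_smul_right, hT, hT,
          ← integral_const_mul]
        refine integral_congr_ae ?_
        filter_upwards [hw.ae_weighted_iff.1 (Lp.coeFn_smul c f)] with x hx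
        rw [hx, Pi.smul_apply, smul_eq_mul, mul_assoc] }
  refine ⟨L.mkContinuous 1 fun f => ?_, hT⟩
  rw [one_mul]
  refine ContinuousLinearMap.opNorm_le_bound _ (norm_nonneg _) fun v => ?_
  -- Taking `u = T f v` gives `‖T f v‖² ≤ ‖f‖ ‖T f v‖ ‖v‖`.
  have h1 := hσ.norm_integral_mul_coeff_le hw f (T f v) v
  rw [← hT, inner_self_eq_norm_sq_to_K, norm_pow, RCLike.norm_ofReal, abs_norm] at h1
  change ‖T f v‖ ≤ _
  rcases (norm_nonneg (T f v)).eq_or_lt with h0 | hpos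
  · rw [← h0]; positivity
  · nlinarith

variable {L : L1w μ w →L[ℂ] H →L[ℂ] H}
  (hL : ∀ f u v, inner ℂ u (L f v) = ∫ x, f x * inner ℂ u (σ x v) ∂μ)

include hL

theorem integrated_mul_comm {T : H →L[ℂ] H} (hT : ∀ x, T * σ x = σ x * T) (f : L1w μ w) :
    L f * T = T * L f := by
  ext v
  refine ext_inner_left ℂ fun u => ?_
  rw [mul_apply_eq_comp, mul_apply_eq_comp, hL,
    ← ContinuousLinearMap.adjoint_inner_left, hL]
  refine integral_congr_ae (Filter.Eventually.of_forall fun x => ?_)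
  beta_reduce
  rw [ContinuousLinearMap.adjoint_inner_left, ← mul_apply_eq_comp T, hT,
    mul_apply_eq_comp]

theorem integrated_comm (hσ : IsDominatedRep w σ) (f g : L1w μ w) : L f * L g = L g * L f :=
  integrated_mul_comm hL (fun y => integrated_mul_comm hL (fun x => by
    rw [← hσ.rep_mul, mul_comm, hσ.rep_mul]) g) f

theorem integrated_star_comm (hσ : IsDominatedRep w σ) (f g : L1w μ w) :
    L f * star (L g) = star (L g) * L f := by
  refine integrated_mul_comm hL (fun y => ?_) f
  have := integrated_mul_comm hL (T := star (σ y)) (fun x => hσ.adjoint_mul y x) g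
  have := congrArg star this
  rw [star_mul, star_mul, star_star] at this
  exact this.symm

end IsDominatedRep

end Integrated

end WeightedGroupAlgebra

namespace WeightedGroupAlgebra

set_option linter.unusedSectionVars false

open scoped CompactlySupported ENNReal Pointwise

/-! ### Integrable functions tested against `C_c`. -/

section Duality

/-- An integrable function that is orthogonal to the continuous functions with compact support
vanishes. -/
theorem ae_eq_zero_of_forall_integral_mul_cc {X : Type*} [TopologicalSpace X] [T2Space X]
    [LocallyCompactSpace X] [MeasurableSpace X] [BorelSpace X] {μ : Measure X} [μ.Regular]
    {F : X → ℂ} (hF : Integrable F μ) (h : ∀ k : C_c(X, ℂ), ∫ x, F x * k x ∂μ = 0) :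
    F =ᵐ[μ] 0 := by
  have key : ∀ δ > 0, ∫ x, ‖F x‖ ∂μ ≤ 3 * δ := fun δ hδ => by
    obtain ⟨p, hpc, hp, hpcont, hpi⟩ := exists_hasCompactSupport_integral_norm_sub_le hF hδ
    set K := tsupport p
    have hK : IsCompact K := hpc.isCompact
    set t : ℝ := δ / (μ.real K + 1)
    have ht : 0 < t := by positivity
    have htK : t * μ.real K ≤ δ := by
      calc t * μ.real K ≤ t * (μ.real K + 1) := by gcongr; linarith
        _ = δ := by simp only [t]; field_simp
    have hden : ∀ x, ((‖p x‖ + t : ℝ) : ℂ) ≠ 0 := fun x => by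
      have : 0 < ‖p x‖ + t := by positivity
      exact_mod_cast this.ne'
    -- A continuous substitute for the conjugate sign of `p`: it has norm at most one, and `p * k`
    -- falls short of `‖p‖` by at most `t` on `K`, a total loss of at most `δ`.
    let k : C_c(X, ℂ) :=
      ⟨⟨fun x => conj (p x) / ((‖p x‖ + t : ℝ) : ℂ), by fun_prop (disch := exact hden _)⟩, by
        refine hpc.mono fun x hx => ?_
        intro h0
        exact hx (by simp [h0])⟩
    have hk : ∀ x, k x = conj (p x) / ((‖p x‖ + t : ℝ) : ℂ) := fun x => rfl
    have hk1 : ∀ x, ‖k x‖ ≤ 1 := fun x => by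
      have : 0 < ‖p x‖ + t := by positivity
      rw [hk, norm_div, RCLike.norm_conj, Complex.norm_real, Real.norm_of_nonneg this.le,
        div_le_one this]
      linarith
    have hpk : ∀ x, ‖p x‖ ≤ (p x * k x).re + K.indicator (fun _ => t) x := fun x => by
      have hpos : 0 < ‖p x‖ + t := by positivity
      have h1 : p x * k x = ((‖p x‖ ^ 2 / (‖p x‖ + t) : ℝ) : ℂ) := by
        rw [hk, ← mul_div_assoc, Complex.mul_conj, Complex.normSq_eq_norm_sq]
        push_cast
        rfl
      rw [h1, Complex.ofReal_re]
      by_cases hx : x ∈ K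
      · rw [Set.indicator_of_mem hx, ← sub_le_iff_le_add, le_div_iff₀ hpos]
        nlinarith [norm_nonneg (p x), sq_nonneg t]
      · rw [show p x = 0 from image_eq_zero_of_notMem_tsupport hx]
        simp [Set.indicator_of_notMem hx]
    have hpki : Integrable (fun x => p x * k x) μ :=
      (hpcont.mul k.continuous).integrable_of_hasCompactSupport hpc.mul_right
    have hFki : Integrable (fun x => F x * k x) μ :=
      hF.mono (hF.aestronglyMeasurable.mul k.continuous.measurable.aestronglyMeasurable)
        (Filter.Eventually.of_forall fun x => by
          rw [norm_mul]; exact mul_le_of_le_one_right (norm_nonneg _) (hk1 x))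
    have hind : Integrable (K.indicator fun _ => t) μ :=
      (integrable_indicator_iff hK.measurableSet).2 (integrableOn_const hK.measure_ne_top)
    have h2 : ∫ x, ‖p x‖ ∂μ ≤ (∫ x, p x * k x ∂μ).re + t * μ.real K := by
      calc _ ≤ ∫ x, ((p x * k x).re + K.indicator (fun _ => t) x) ∂μ :=
            integral_mono hpi.norm (hpki.re.add hind) hpk
        _ = _ := by
          have h4 : ∫ x, (p x * k x).re ∂μ = (∫ x, p x * k x ∂μ).re := integral_re hpki
          have h5 : Integrable (fun x => (p x * k x).re) μ := hpki.re
          rw [integral_add h5 hind, integral_indicator_const _ hK.measurableSet, smul_eq_mul,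
            mul_comm t, h4]
    have h3 : (∫ x, p x * k x ∂μ).re ≤ δ := by
      refine (Complex.re_le_norm _).trans (le_trans ?_ hp)
      rw [← norm_neg, ← zero_sub, ← h k, ← integral_sub hFki hpki]
      refine norm_integral_le_of_norm_le (hF.sub hpi).norm (Filter.Eventually.of_forall fun x => ?_)
      rw [← sub_mul, norm_mul]
      exact mul_le_of_le_one_right (norm_nonneg _) (hk1 x)
    have h5 : ∫ x, ‖F x‖ ∂μ ≤ ∫ x, ‖F x - p x‖ ∂μ + ∫ x, ‖p x‖ ∂μ := by
      have h6 : Integrable (fun x => ‖F x - p x‖) μ := (hF.sub hpi).norm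
      rw [← integral_add h6 hpi.norm]
      refine integral_mono hF.norm (h6.add hpi.norm) fun x => ?_
      simpa using norm_add_le (F x - p x) (p x)
    linarith
  have h0 : ∫ x, ‖F x‖ ∂μ = 0 := by
    refine le_antisymm (le_of_forall_pos_le_add fun ε hε => ?_) (by positivity)
    have := key (ε / 3) (by positivity)
    linarith
  rw [integral_eq_zero_iff_of_nonneg (fun _ => norm_nonneg _) hF.norm] at h0
  filter_upwards [h0] with x hx
  simpa using hx

end Duality

/-! ### The twisted regular representation and semisimplicity. -/

section Regular

variable {G : Type*} [CommGroup G] [TopologicalSpace G] [IsTopologicalGroup G]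
    [MeasurableSpace G] [BorelSpace G] {μ : Measure G} [μ.IsHaarMeasure] {w : G → ℝ}

theorem IsDominatedRep.integrated_convCc {H : Type*} [NormedAddCommGroup H]
    [InnerProductSpace ℂ H] [CompleteSpace H] {σ : G → H →L[ℂ] H} (hσ : IsDominatedRep w σ)
    (hw : IsWeight w) [IsFiniteMeasureOnCompacts (weighted μ w)]
    {L : L1w μ w →L[ℂ] H →L[ℂ] H}
    (hL : ∀ f u v, inner ℂ u (L f v) = ∫ x, f x * inner ℂ u (σ x v) ∂μ) (p q : C_c(G, ℂ)) :
    L (ofCc (weighted μ w) (convCc μ p q)) =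
      L (ofCc (weighted μ w) p) * L (ofCc (weighted μ w) q) := by
  have hL' : ∀ (p : C_c(G, ℂ)) u v, inner ℂ u (L (ofCc (weighted μ w) p) v) =
      ∫ x, p x * inner ℂ u (σ x v) ∂μ := fun p u v => by
    rw [hL]
    refine integral_congr_ae ?_
    filter_upwards [hw.ae_weighted_iff.1 (coeFn_ofCc (weighted μ w) p)] with x hx
    rw [hx]
  ext v
  refine ext_inner_left ℂ fun u => ?_
  rw [mul_apply_eq_comp, hL', hL', coe_convCc, integral_conv_mul μ p q (hσ.continuous_coeff u v)]
  refine integral_congr_ae (Filter.Eventually.of_forall fun y => ?_)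
  beta_reduce
  rw [← ContinuousLinearMap.adjoint_inner_left, hL']
  congr 1
  refine integral_congr_ae (Filter.Eventually.of_forall fun x => ?_)
  beta_reduce
  rw [ContinuousLinearMap.adjoint_inner_left, hσ.rep_mul, mul_apply_eq_comp]

variable [LocallyCompactSpace G] [T2Space G] [μ.Regular]

/-- The operators `L f` commute with each other and with each other's adjoints, so a character of
the C⋆-algebra they generate detects `L f`; its pullback along `L` is multiplicative, as verified on
`C_c`. -/
theorem IsDominatedRep.exists_mem_characterSpace {H : Type*} [NormedAddCommGroup H]
    [InnerProductSpace ℂ H] [CompleteSpace H] {σ : G → H →L[ℂ] H} (hσ : IsDominatedRep w σ)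
    (hw : IsWeight w) [IsFiniteMeasureOnCompacts (weighted μ w)]
    {L : L1w μ w →L[ℂ] H →L[ℂ] H}
    (hL : ∀ f u v, inner ℂ u (L f v) = ∫ x, f x * inner ℂ u (σ x v) ∂μ)
    {f : L1w μ w} (hf : L f ≠ 0) : ∃ φ ∈ characterSpace μ w, φ f ≠ 0 := by
  obtain ⟨B, hB, ψ, hψ, hψf⟩ := exists_multiplicative_functional_ne_zero (Set.range L)
    (by rintro _ ⟨a, rfl⟩ _ ⟨b, rfl⟩; exact integrated_comm hL hσ a b)
    (by rintro _ ⟨a, rfl⟩ _ ⟨b, rfl⟩; exact integrated_star_comm hL hσ a b)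
    (Set.mem_range_self f) hf
  let L' : L1w μ w →L[ℂ] B := L.codRestrict B.toSubalgebra.toSubmodule
    fun f => hB (Set.mem_range_self f)
  let φ : L1w μ w →L[ℂ] ℂ := ψ.comp L'
  have hφf : φ f ≠ 0 := hψf
  refine ⟨φ, ⟨fun h0 => hφf ?_, ?_⟩, hφf⟩
  · change (φ : WeakDual ℂ (L1w μ w)) = 0 at h0
    exact DFunLike.congr_fun h0 f
  · refine hw.map_eq_mul_of_forall_cc μ φ fun p q => ?_
    change ψ _ = ψ _ * ψ _
    rw [← hψ]
    congr 1
    exact Subtype.ext (hσ.integrated_convCc hw hL p q)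

/-- Translation on `L²(G)`, twisted by a positive multiplicative function. -/
noncomputable def twistedTranslation (μ : Measure G) [μ.IsHaarMeasure] (α : G → ℝ) (x : G) :
    Lp ℂ 2 μ →L[ℂ] Lp ℂ 2 μ :=
  (α x : ℂ) • LinearMap.mkContinuous
    { toFun := fun v => DomMulAct.mk x • v
      map_add' := smul_add _
      map_smul' := fun c v => smul_comm _ c v } 1 (fun v => by simp)

theorem twistedTranslation_apply (α : G → ℝ) (x : G) (v : Lp ℂ 2 μ) :
    twistedTranslation μ α x v = (α x : ℂ) • (DomMulAct.mk x • v) := rfl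

theorem inner_mk_smul_mk_smul (x : G) (u v : Lp ℂ 2 μ) :
    inner ℂ (DomMulAct.mk x • u) (DomMulAct.mk x • v) = inner ℂ u v := by
  let T : Lp ℂ 2 μ →ₗᵢ[ℂ] Lp ℂ 2 μ := ⟨
    { toFun := fun v => DomMulAct.mk x • v
      map_add' := smul_add _
      map_smul' := fun c v => smul_comm _ c v }, fun v => by simp⟩
  exact T.inner_map_map u v

theorem star_twistedTranslation_apply (α : G → ℝ) (x : G) (v : Lp ℂ 2 μ) :
    star (twistedTranslation μ α x) v = (α x : ℂ) • (DomMulAct.mk x⁻¹ • v) := by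
  refine ext_inner_left ℂ fun u => ?_
  rw [ContinuousLinearMap.star_eq_adjoint, ContinuousLinearMap.adjoint_inner_right,
    twistedTranslation_apply, inner_smul_left, inner_smul_right, Complex.conj_ofReal,
    ← inner_mk_smul_mk_smul x u, smul_smul, ← DomMulAct.mk_mul, inv_mul_cancel, DomMulAct.mk_one,
    one_smul]

theorem isDominatedRep_twistedTranslation {α : G → ℝ} (hα : Continuous α) (hα0 : ∀ x, 0 < α x)
    (hαm : ∀ x y, α (x * y) = α x * α y) (hαw : ∀ x, α x ≤ w x) :
    IsDominatedRep w (twistedTranslation μ α) where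
  rep_mul x y := by
    ext1 v
    rw [mul_apply_eq_comp]
    simp_rw [twistedTranslation_apply]
    rw [smul_comm (DomMulAct.mk x), smul_smul, smul_smul, ← DomMulAct.mk_mul, mul_comm y x, hαm]
    push_cast
    rfl
  continuous_apply v := by
    simp_rw [twistedTranslation_apply]
    have : Fact ((2 : ℝ≥0∞) ≠ ∞) := ⟨by simp⟩
    have h1 : Continuous fun x : G => DomMulAct.mk x • v :=
      (DomMulAct.continuous_mk (M := G)).smul continuous_const
    exact (Complex.continuous_ofReal.comp hα).smul h1
  norm_apply_le x v := by
    rw [twistedTranslation_apply, norm_smul, Complex.norm_real, Real.norm_of_nonneg (hα0 x).le,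
      DomMulAct.norm_smul_Lp]
    gcongr
    exact hαw x
  adjoint_mul x y := by
    ext1 v
    rw [mul_apply_eq_comp, mul_apply_eq_comp, star_twistedTranslation_apply,
      star_twistedTranslation_apply, twistedTranslation_apply, twistedTranslation_apply,
      smul_comm (DomMulAct.mk x⁻¹), smul_comm (DomMulAct.mk y), smul_smul (DomMulAct.mk y),
      smul_smul (DomMulAct.mk x⁻¹), ← DomMulAct.mk_mul, ← DomMulAct.mk_mul, mul_comm y,
      smul_comm (α x : ℂ)]

omit [LocallyCompactSpace G] [T2Space G] [μ.Regular] [μ.IsHaarMeasure] [MeasurableSpace G]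
  [BorelSpace G] in
theorem eventually_forall_norm_comp_mul_sub_le [LocallyCompactSpace G] [T2Space G]
    (k : C_c(G, ℂ)) {ε : ℝ} (hε : 0 < ε) :
    ∀ᶠ y in 𝓝 (1 : G), ∀ x, ‖k (x * y) - k x‖ ≤ ε := by
  obtain ⟨N, hN, hN1⟩ := exists_compact_mem_nhds (1 : G)
  have hK : IsCompact (tsupport k * N⁻¹) := k.hasCompactSupport.isCompact.mul hN.inv
  have h1 : ∀ᶠ y in 𝓝 (1 : G), ∀ x ∈ tsupport k * N⁻¹, ‖k (x * y) - k x‖ ≤ ε := by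
    refine hK.eventually_forall_of_forall_eventually (P := fun y x => ‖k (x * y) - k x‖ ≤ ε)
      fun x _ => ?_
    have hc : Continuous fun z : G × G => ‖k (z.2 * z.1) - k z.2‖ :=
      ((k.continuous.comp (continuous_snd.mul continuous_fst)).sub
        (k.continuous.comp continuous_snd)).norm
    have := (hc.tendsto (1, x)).eventually_lt_const (u := ε) (by simpa using hε)
    exact this.mono fun z hz => hz.le
  filter_upwards [h1, hN1] with y hy hyN x
  by_cases hx : x ∈ tsupport k * N⁻¹
  · exact hy x hx
  · have h2 : x ∉ tsupport k := fun h => hx ⟨x, h, 1, by simpa using mem_of_mem_nhds hN1, by simp⟩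
    have h3 : x * y ∉ tsupport k := fun h => hx ⟨x * y, h, y⁻¹, Set.inv_mem_inv.2 hyN, by simp⟩
    rw [image_eq_zero_of_notMem_tsupport h2, image_eq_zero_of_notMem_tsupport h3]
    simpa using hε.le

/-- For a bump `θ` near 1, the coefficient `∫ θ(y) k(xy) dy` is uniformly close to `(∫ θ) k(x)`.
Thus orthogonality to all coefficients passes to all of `C_c`. -/
theorem ae_eq_zero_of_forall_integral_mul_inner {F : G → ℂ} (hF : Integrable F μ)
    (h : ∀ u v : Lp ℂ 2 μ, ∫ x, F x * inner ℂ u (DomMulAct.mk x • v) ∂μ = 0) : F =ᵐ[μ] 0 := by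
  refine ae_eq_zero_of_forall_integral_mul_cc hF fun k => ?_
  rw [← norm_le_zero_iff]
  have hkey : ∀ ε > 0, ‖∫ x, F x * k x ∂μ‖ ≤ (∫ x, ‖F x‖ ∂μ) * ε := fun ε hε => by
    obtain ⟨U, hU, hUo, hU1⟩ := eventually_nhds_iff.1 (eventually_forall_norm_comp_mul_sub_le k hε)
    obtain ⟨θ, hθ1, hθ0, hθc, hθI⟩ := exists_continuous_one_zero_of_isCompact
      (isCompact_singleton (x := (1 : G))) hUo.isClosed_compl
      (Set.disjoint_singleton_left.2 fun h => h hU1)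
    have hθi : Integrable θ μ := θ.continuous.integrable_of_hasCompactSupport hθc
    set c := ∫ y, θ y ∂μ
    have hc : 0 < c := by
      refine θ.continuous.integral_pos_of_hasCompactSupport_nonneg_nonzero hθc
        (fun x => (hθI x).1) (x := 1) ?_
      rw [hθ1 rfl]
      exact one_ne_zero
    have hθ2 : MemLp (fun y => (θ y : ℂ)) 2 μ :=
      Continuous.memLp_of_hasCompactSupport (by fun_prop)
        (hθc.comp_left (g := fun r : ℝ => (r : ℂ)) (by simp))
    have hk2 : MemLp k 2 μ := k.continuous.memLp_of_hasCompactSupport k.hasCompactSupport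
    have hinner : ∀ x, inner ℂ hθ2.toLp (DomMulAct.mk x • hk2.toLp) =
        ∫ y, (θ y : ℂ) * k (x * y) ∂μ := fun x => by
      rw [DomMulAct.mk_smul_toLp, L2.inner_def]
      refine integral_congr_ae ?_
      filter_upwards [hθ2.coeFn_toLp, (hk2.comp_measurePreserving
        (measurePreserving_smul x μ)).coeFn_toLp] with y h1 h2
      rw [h1]
      refine (congrArg (inner ℂ _) h2).trans ?_
      simp [mul_comm]
    have hdiff : ∀ x, ‖(c : ℂ) * k x - ∫ y, (θ y : ℂ) * k (x * y) ∂μ‖ ≤ c * ε := fun x => by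
      have i1 : Integrable (fun y => (θ y : ℂ) * k x) μ := hθi.ofReal.mul_const _
      have i2 : Integrable (fun y => (θ y : ℂ) * k (x * y)) μ :=
        Continuous.integrable_of_hasCompactSupport
          ((Complex.continuous_ofReal.comp θ.continuous).mul
            (k.continuous.comp (continuous_const.mul continuous_id)))
          (hθc.comp_left (g := fun r : ℝ => (r : ℂ)) (by simp)).mul_right
      have e1 : (c : ℂ) * k x = ∫ y, (θ y : ℂ) * k x ∂μ := by
        rw [integral_mul_const, integral_complex_ofReal]
      rw [e1, ← integral_sub i1 i2]
      calc _ ≤ ∫ y, θ y * ε ∂μ := by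
            refine norm_integral_le_of_norm_le (hθi.mul_const ε)
              (Filter.Eventually.of_forall fun y => ?_)
            rw [← mul_sub, norm_mul, Complex.norm_real, Real.norm_of_nonneg (hθI y).1]
            by_cases hy : y ∈ U
            · have := hU y hy x
              rw [norm_sub_rev] at this
              exact mul_le_mul_of_nonneg_left this (hθI y).1
            · have : θ y = 0 := hθ0 hy
              simp [this]
        _ = c * ε := by rw [integral_mul_const]
    have hFk : Integrable (fun x => F x * ((c : ℂ) * k x)) μ := by
      obtain ⟨C, hC⟩ := k.hasCompactSupport.exists_bound_of_continuous k.continuous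
      refine (hF.norm.mul_const (c * C)).mono' (hF.aestronglyMeasurable.mul
        (continuous_const.mul k.continuous).measurable.aestronglyMeasurable)
        (Filter.Eventually.of_forall fun x => ?_)
      rw [norm_mul, norm_mul, Complex.norm_real, Real.norm_of_nonneg hc.le]
      gcongr
      exact hC x
    have hFi : Integrable (fun x => F x * ∫ y, (θ y : ℂ) * k (x * y) ∂μ) μ := by
      -- The untwisted case `α = w = 1` supplies continuity and boundedness of the coefficient.
      have hσ := isDominatedRep_twistedTranslation (μ := μ) (α := fun _ : G => 1)
        (w := fun _ => 1) continuous_const (fun _ => one_pos) (fun _ _ => (one_mul 1).symm)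
        fun _ => le_rfl
      have hi := hσ.continuous_coeff hθ2.toLp hk2.toLp
      have hb := fun x => (norm_inner_le_norm (𝕜 := ℂ) _ _).trans
        (mul_le_mul_of_nonneg_left (hσ.norm_apply_le x hk2.toLp) (norm_nonneg hθ2.toLp))
      simp_rw [twistedTranslation_apply, Complex.ofReal_one, one_smul, hinner] at hi hb
      refine hF.mul_bdd hi.measurable.aestronglyMeasurable
        (Filter.Eventually.of_forall fun x => hb x)
    have h0 := h hθ2.toLp hk2.toLp
    simp_rw [hinner] at h0
    have h1 : c * ‖∫ x, F x * k x ∂μ‖ ≤ c * ((∫ x, ‖F x‖ ∂μ) * ε) := by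
      calc c * ‖∫ x, F x * k x ∂μ‖ = ‖∫ x, F x * ((c : ℂ) * k x) ∂μ‖ := by
            simp_rw [mul_left_comm (F _)]
            rw [integral_const_mul, norm_mul, Complex.norm_real, Real.norm_of_nonneg hc.le]
        _ = ‖∫ x, F x * ((c : ℂ) * k x - ∫ y, (θ y : ℂ) * k (x * y) ∂μ) ∂μ‖ := by
            simp_rw [mul_sub (F _)]
            rw [integral_sub hFk hFi, h0, sub_zero]
        _ ≤ ∫ x, ‖F x‖ * (c * ε) ∂μ := by
            refine norm_integral_le_of_norm_le (hF.norm.mul_const _)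
              (Filter.Eventually.of_forall fun x => ?_)
            rw [norm_mul]
            exact mul_le_mul_of_nonneg_left (hdiff x) (norm_nonneg _)
        _ = _ := by rw [integral_mul_const]; ring
    exact le_of_mul_le_mul_left h1 hc
  have hlim : Filter.Tendsto (fun ε => (∫ x, ‖F x‖ ∂μ) * ε) (𝓝[>] 0) (𝓝 0) := by
    have : Filter.Tendsto (fun ε => (∫ x, ‖F x‖ ∂μ) * ε) (𝓝 0) (𝓝 ((∫ x, ‖F x‖ ∂μ) * 0)) :=
      Filter.tendsto_id.const_mul _
    rw [mul_zero] at this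
    exact this.mono_left nhdsWithin_le_nhds
  exact ge_of_tendsto hlim (Filter.eventually_of_mem self_mem_nhdsWithin hkey)

/-- The characters of `L¹(G, w)` separate its points. -/
theorem IsWeight.eq_zero_of_forall_character (hw : IsWeight w) {f : L1w μ w}
    (hf : ∀ φ ∈ characterSpace μ w, φ f = 0) : f = 0 := by
  have := hw.isFiniteMeasureOnCompacts_weighted μ
  obtain ⟨α, hα, hα0, hαm, hαw⟩ := hw.exists_continuous_mul_le μ
  have hσ := isDominatedRep_twistedTranslation (μ := μ) hα hα0 hαm hαw
  obtain ⟨L, hL⟩ := hσ.exists_integrated (μ := μ) hw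
  have hLf : L f = 0 := by
    by_contra h
    obtain ⟨φ, hφ, h0⟩ := hσ.exists_mem_characterSpace hw hL h
    exact h0 (hf φ hφ)
  -- Since `α ≤ w`, the twist moves `f` into `L¹(μ)`, where the unweighted coefficients of
  -- translation separate.
  have hF : Integrable (fun x => f x * (α x : ℂ)) μ := by
    have h1 : Integrable (fun x => w x • f x) μ :=
      hw.integrable_weighted_iff.1 (L1.integrable_coeFn f)
    refine h1.mono ?_ (Filter.Eventually.of_forall fun x => ?_)
    · obtain ⟨g, hg, hfg⟩ := Lp.aestronglyMeasurable f
      exact AEStronglyMeasurable.mul ⟨g, hg, hw.ae_weighted_iff.1 hfg⟩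
        (Complex.continuous_ofReal.comp hα).measurable.aestronglyMeasurable
    · rw [norm_mul, norm_smul, Complex.norm_real, Real.norm_of_nonneg (hα0 x).le,
        Real.norm_of_nonneg (hw.pos x).le, mul_comm]
      gcongr
      exact hαw x
  have h0 := ae_eq_zero_of_forall_integral_mul_inner hF fun u v => by
    have := hL f u v
    rw [hLf, zero_apply, inner_zero_right] at this
    rw [this]
    refine integral_congr_ae (Filter.Eventually.of_forall fun x => ?_)
    beta_reduce
    rw [twistedTranslation_apply, inner_smul_right, mul_assoc]
  refine Lp.ext ?_
  have h1 : ⇑f =ᵐ[weighted μ w] 0 := hw.ae_weighted_iff.2 ?_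
  · exact h1.trans (Lp.coeFn_zero ℂ 1 _).symm
  filter_upwards [h0] with x hx
  have hne : (α x : ℂ) ≠ 0 := by exact_mod_cast (hα0 x).ne'
  exact (mul_eq_zero.1 hx).resolve_right hne

end Regular

end WeightedGroupAlgebra

namespace WeightedGroupAlgebra

set_option linter.unusedSectionVars false

open scoped CompactlySupported

/-! ### The character space, and both implications towards finiteness. -/

section CharacterSpace

variable {G : Type*} [CommGroup G] [TopologicalSpace G] [IsTopologicalGroup G]
    [LocallyCompactSpace G] [T2Space G] [MeasurableSpace G] [BorelSpace G] {μ : Measure G}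
    [μ.IsHaarMeasure] [μ.Regular] {w : G → ℝ}

theorem IsWeight.coeFn_ofCc_convCc (hw : IsWeight w) [IsFiniteMeasureOnCompacts (weighted μ w)]
    (u v : C_c(G, ℂ)) : ⇑(ofCc (weighted μ w) (convCc μ u v)) =ᵐ[μ]
      conv μ (ofCc (weighted μ w) u) (ofCc (weighted μ w) v) := by
  have h0 : ⇑(ofCc (weighted μ w) (convCc μ u v)) =ᵐ[μ] conv μ u v :=
    hw.ae_weighted_iff.1 (coeFn_ofCc (weighted μ w) (convCc μ u v))
  refine h0.trans (Filter.Eventually.of_forall fun x => ?_)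
  have hq : Measure.QuasiMeasurePreserving (fun y : G => y⁻¹ * x) μ μ :=
    ((measurePreserving_mul_right μ x).comp (Measure.measurePreserving_inv μ)).quasiMeasurePreserving
  have hu := hw.ae_weighted_iff.1 (coeFn_ofCc (weighted μ w) u)
  have hv := hw.ae_weighted_iff.1 (coeFn_ofCc (weighted μ w) v)
  refine integral_congr_ae ?_
  filter_upwards [hu, hq.ae hv] with y h1 h2
  rw [h1, h2]

/-- Multiplicativity on the dense `C_c` gives `|φ(u)| ‖φ‖ ≤ ‖φ‖ ‖u‖`; then divide by `‖φ‖ > 0`. -/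
theorem IsWeight.norm_character_apply_le (hw : IsWeight w) {φ : WeakDual ℂ (L1w μ w)}
    (hφ : φ ∈ characterSpace μ w) (f : L1w μ w) : ‖φ f‖ ≤ ‖f‖ := by
  have := hw.isFiniteMeasureOnCompacts_weighted μ
  let ψ : L1w μ w →L[ℂ] ℂ := WeakDual.toStrongDual φ
  change ‖ψ f‖ ≤ ‖f‖
  have hd := hw.denseRange_ofCc μ
  have hψ : 0 < ‖ψ‖ := norm_pos_iff.2 fun h => hφ.1 (by
    exact DFunLike.ext _ _ fun f => DFunLike.congr_fun h f)
  refine hd.induction_on f (isClosed_le (by fun_prop) (by fun_prop)) fun u => ?_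
  have h1 : ‖ψ (ofCc _ u) • ψ‖ ≤ ‖ψ‖ * ‖ofCc (weighted μ w) u‖ := by
    refine ContinuousLinearMap.opNorm_le_bound _ (by positivity) fun g => ?_
    refine hd.induction_on g (isClosed_le (by fun_prop) (by fun_prop)) fun v => ?_
    rw [smul_apply, smul_eq_mul]
    have h2 : ψ (ofCc (weighted μ w) (convCc μ u v)) = ψ (ofCc _ u) * ψ (ofCc _ v) :=
      hφ.2 _ _ _ (hw.coeFn_ofCc_convCc u v)
    rw [← h2, mul_assoc]
    exact (ψ.le_opNorm _).trans (by gcongr; exact hw.norm_ofCc_convCc_le μ u v)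
  rw [norm_smul, mul_comm] at h1
  exact le_of_mul_le_mul_left h1 hψ

/-- Adding the zero functional gives a weak-* closed subset of the unit ball, compact by
Banach-Alaoglu, in which the character space is open. -/
theorem IsWeight.locallyCompactSpace_characterSpace (hw : IsWeight w) :
    LocallyCompactSpace (characterSpace μ w) := by
  let K : Set (WeakDual ℂ (L1w μ w)) :=
    {φ | ∀ f g h : L1w μ w, ⇑h =ᵐ[μ] conv μ f g → φ h = φ f * φ g}
  have hcl : IsClosed K := by
    simp only [K, Set.ofPred_forall]
    refine isClosed_iInter fun f => isClosed_iInter fun g => isClosed_iInter fun h =>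
      isClosed_iInter fun _ => ?_
    exact isClosed_eq (WeakDual.eval_continuous h)
      ((WeakDual.eval_continuous f).mul (WeakDual.eval_continuous g))
  have hK : IsCompact K := by
    refine (WeakDual.isCompact_closedBall (𝕜 := ℂ) (E := L1w μ w) 0 1).of_isClosed_subset hcl
      fun φ hφ => ?_
    rw [Set.mem_preimage, mem_closedBall_zero_iff]
    refine ContinuousLinearMap.opNorm_le_bound _ zero_le_one fun f => ?_
    rw [one_mul]
    by_cases h0 : φ = 0
    · rw [h0]
      change ‖(0 : ℂ)‖ ≤ _
      simp
    · exact hw.norm_character_apply_le ⟨h0, hφ⟩ f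
  have : CompactSpace K := isCompact_iff_compactSpace.1 hK
  have hsub : characterSpace μ w ⊆ K := fun φ hφ => hφ.2
  have hemb : IsOpenEmbedding (Set.inclusion hsub) := by
    refine ⟨IsEmbedding.inclusion hsub, ?_⟩
    have : Set.range (Set.inclusion hsub) = (Subtype.val : K → _) ⁻¹' {0}ᶜ := by
      ext φ
      rw [Set.range_inclusion]
      exact ⟨fun h => h.1, fun h => ⟨h, φ.2⟩⟩
    rw [this]
    exact isOpen_compl_singleton.preimage continuous_subtype_val
  exact hemb.locallyCompactSpace

theorem finiteDimensional_of_injective_eval {X E : Type*} [Finite X] [AddCommGroup E] [Module ℂ E]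
    (e : X → E →ₗ[ℂ] ℂ) (hinj : ∀ f, (∀ x, e x f = 0) → f = 0) : FiniteDimensional ℂ E :=
  Module.Finite.of_injective (LinearMap.pi e)
    ((injective_iff_map_eq_zero _).2 fun f hf => hinj f fun x => congrFun hf x)

theorem IsWeight.finite_of_surjective_gelfandTransform (hw : IsWeight w)
    (h : ∀ F : C₀(characterSpace μ w, ℂ), ∃ f : L1w μ w, gelfandTransform μ w f = ⇑F) :
    Finite G := by
  have := hw.isFiniteMeasureOnCompacts_weighted μ
  have := hw.isOpenPosMeasure_weighted μ
  have := hw.locallyCompactSpace_characterSpace (μ := μ)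
  let e : characterSpace μ w → L1w μ w →L[ℂ] ℂ := fun φ => WeakDual.toStrongDual φ.1
  have hinj : ∀ f, (∀ φ, e φ f = 0) → f = 0 := fun f hf =>
    hw.eq_zero_of_forall_character fun φ hφ => hf ⟨φ, hφ⟩
  have : Finite (characterSpace μ w) := finite_of_surjective_evaluation e
    (fun φ f => hw.norm_character_apply_le φ.2 f) hinj fun F => by
      obtain ⟨f, hf⟩ := h F
      exact ⟨f, fun φ => congrFun hf φ⟩
  have : FiniteDimensional ℂ (L1w μ w) :=
    finiteDimensional_of_injective_eval (fun φ => (e φ).toLinearMap) hinj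
  exact finite_of_finiteDimensional_L1 (ν := weighted μ w)

/-- The Fourier transform is bounded by the norm of `L¹(G)`. -/
theorem norm_fourierTransform_le (f : Lp ℂ 1 μ) (χ : PontryaginDual G) :
    ‖fourierTransform μ f χ‖ ≤ ‖f‖ := by
  rw [L1.norm_eq_integral_norm]
  refine norm_integral_le_of_norm_le (L1.integrable_coeFn f).norm
    (Filter.Eventually.of_forall fun x => ?_)
  rw [norm_mul, RCLike.norm_conj, Circle.norm_coe, one_mul]

theorem integrable_conj_mul (f : Lp ℂ 1 μ) (χ : PontryaginDual G) :
    Integrable (fun x => conj (χ x : ℂ) * f x) μ := by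
  refine (L1.integrable_coeFn f).bdd_mul (c := 1) ?_ (Filter.Eventually.of_forall fun x => by
    rw [RCLike.norm_conj, Circle.norm_coe])
  have : Continuous fun x => conj (χ x : ℂ) :=
    Complex.continuous_conj.comp (continuous_subtype_val.comp (map_continuous χ))
  exact this.measurable.aestronglyMeasurable

variable (μ) in
/-- The Fourier transform at a character, as a functional on `L¹(G)`. -/
noncomputable def fourierFunctional (χ : PontryaginDual G) : Lp ℂ 1 μ →L[ℂ] ℂ :=
  LinearMap.mkContinuous
    { toFun := fun f => fourierTransform μ f χ
      map_add' := fun f g => by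
        simp only [fourierTransform]
        rw [← integral_add (integrable_conj_mul f χ) (integrable_conj_mul g χ)]
        refine integral_congr_ae ?_
        filter_upwards [Lp.coeFn_add f g] with x hx
        rw [hx, Pi.add_apply, mul_add]
      map_smul' := fun c f => by
        simp only [fourierTransform]
        rw [RingHom.id_apply, smul_eq_mul, ← integral_const_mul]
        refine integral_congr_ae ?_
        filter_upwards [Lp.coeFn_smul c f] with x hx
        rw [hx, Pi.smul_apply, smul_eq_mul, mul_left_comm] } 1
    fun f => by
      rw [one_mul]
      exact norm_fourierTransform_le f χ

theorem fourierFunctional_apply (χ : PontryaginDual G) (f : Lp ℂ 1 μ) :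
    fourierFunctional μ χ f = fourierTransform μ f χ := rfl

theorem finite_of_bijOn_fourierTransform
    (h : Set.BijOn (fourierTransform (G := G) μ) Set.univ
      (Set.range fun F : C₀(PontryaginDual G, ℂ) => (⇑F : PontryaginDual G → ℂ))) :
    Finite G := by
  have hinj : ∀ f, (∀ χ, fourierFunctional μ χ f = 0) → f = 0 := fun f hf => by
    refine h.injOn (Set.mem_univ _) (Set.mem_univ _) (funext fun χ => ?_)
    rw [← fourierFunctional_apply, ← fourierFunctional_apply, hf, map_zero]
  have : Finite (PontryaginDual G) := finite_of_surjective_evaluation (fourierFunctional μ)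
    (fun χ f => norm_fourierTransform_le f χ) hinj fun F => by
      obtain ⟨f, -, hf⟩ := h.surjOn ⟨F, rfl⟩
      exact ⟨f, fun χ => congrFun hf χ⟩
  have : FiniteDimensional ℂ (Lp ℂ 1 μ) :=
    finiteDimensional_of_injective_eval (fun χ => (fourierFunctional μ χ).toLinearMap) hinj
  exact finite_of_finiteDimensional_L1 (ν := μ)

end CharacterSpace

end WeightedGroupAlgebra

/-! ### Finite groups: the converse implications. -/

namespace WeightedGroupAlgebra

set_option linter.unusedSectionVars false

/-- By Dedekind's independence of characters, `χ i ↦ F i` defines a functional on their span. Any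
extension to `ℂ^G` is a sum against its values on the coordinate vectors. -/
theorem exists_sum_mul_monoidHom_eq {G ι : Type*} [Monoid G] [Fintype G] {χ : ι → G →* ℂ}
    (hχ : Function.Injective χ) (F : ι → ℂ) : ∃ f : G → ℂ, ∀ i, ∑ x, f x * χ i x = F i := by
  classical
  have hli : LinearIndependent ℂ fun i => (χ i : G → ℂ) :=
    (linearIndependent_monoidHom G ℂ).comp χ hχ
  obtain ⟨l, hl⟩ := ((Module.Basis.span hli).constr ℂ F).exists_extend
  refine ⟨fun x => l (Pi.single x 1), fun i => ?_⟩
  have h1 : l (χ i) = F i := by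
    have := DFunLike.congr_fun hl (Module.Basis.span hli i)
    rw [Module.Basis.constr_basis, LinearMap.comp_apply, Submodule.subtype_apply,
      Module.Basis.span_apply] at this
    exact this
  rw [← h1, LinearMap.pi_apply_eq_sum_univ l]
  refine Finset.sum_congr rfl fun x _ => ?_
  rw [smul_eq_mul, mul_comm]
  refine congrArg (_ * l ·) (funext fun y => ?_)
  simp [Pi.single_apply, eq_comm]

section Finite

variable {X : Type*} [Finite X] [MeasurableSpace X] [DiscreteMeasurableSpace X]
  (ν : Measure X) [IsFiniteMeasure ν]

/-- Every function on a finite space as an element of `L¹`. -/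
noncomputable def ofFun : (X → ℂ) →ₗ[ℂ] Lp ℂ 1 ν where
  toFun h := (MemLp.of_discrete : MemLp h 1 ν).toLp h
  map_add' _ _ := rfl
  map_smul' _ _ := rfl

theorem coeFn_ofFun (h : X → ℂ) : ⇑(ofFun ν h) =ᵐ[ν] h :=
  (MemLp.of_discrete : MemLp h 1 ν).coeFn_toLp

theorem ofFun_coeFn (f : Lp ℂ 1 ν) : ofFun ν f = f := Lp.toLp_coeFn f (Lp.memLp f)

end Finite

section FiniteGroup

variable {G : Type*} [CommGroup G] [TopologicalSpace G] [IsTopologicalGroup G]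
  [T2Space G] [MeasurableSpace G] [BorelSpace G] [Finite G] (μ : Measure G) [μ.IsHaarMeasure]

theorem ae_eq_iff_eq_of_finite {f g : G → ℂ} : f =ᵐ[μ] g ↔ f = g :=
  Continuous.ae_eq_iff_eq μ continuous_of_discreteTopology continuous_of_discreteTopology

theorem real_singleton_pos (x : G) : 0 < μ.real {x} :=
  ENNReal.toReal_pos ((isOpen_discrete {x}).measure_ne_zero μ ⟨x, rfl⟩) (measure_ne_top μ _)

/-- Point masses divided by the Haar mass of a point multiply like group elements. -/
theorem conv_single_single [DecidableEq G] (x y : G) :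
    conv μ (Pi.single x ((μ.real {1} : ℂ))⁻¹) (Pi.single y ((μ.real {1} : ℂ))⁻¹) =
      Pi.single (x * y) ((μ.real {1} : ℂ))⁻¹ := by
  have := Fintype.ofFinite G
  have hc : (μ.real {1} : ℂ) ≠ 0 := by exact_mod_cast (real_singleton_pos μ 1).ne'
  ext z
  rw [conv, integral_fintype (Integrable.of_finite), Finset.sum_eq_single x]
  · have : μ.real {x} = μ.real {1} := by rw [Measure.real, Measure.haar_singleton, Measure.real]
    rw [this, Pi.single_eq_same, Complex.real_smul, mul_inv_cancel_left₀ hc]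
    simp only [Pi.single_apply, inv_mul_eq_iff_eq_mul]
  · intro t _ ht
    rw [Pi.single_eq_of_ne ht, zero_mul, smul_zero]
  · simp

variable {w : G → ℝ}

/-- Evaluating algebra characters on normalised point masses gives distinct homomorphisms `G →* ℂ`,
to which Dedekind interpolation applies. -/
theorem IsWeight.surjective_gelfandTransform_of_finite (hw : IsWeight w)
    (F : characterSpace μ w → ℂ) : ∃ f : L1w μ w, gelfandTransform μ w f = F := by
  classical
  have := Fintype.ofFinite G
  have : IsFiniteMeasure (weighted μ w) := by
    refine ⟨?_⟩
    rw [← lintegral_one, hw.lintegral_weighted, lintegral_fintype]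
    exact ENNReal.sum_lt_top.2 fun x _ => by
      rw [mul_one]
      exact ENNReal.mul_lt_top ENNReal.ofReal_lt_top (measure_lt_top μ _)
  set c : ℂ := (μ.real {1} : ℂ)
  have hc : c ≠ 0 := Complex.ofReal_ne_zero.2 (real_singleton_pos μ 1).ne'
  let T : (G → ℂ) →ₗ[ℂ] L1w μ w := ofFun (weighted μ w)
  have hT : ∀ h, ⇑(T h) = h := fun h =>
    (ae_eq_iff_eq_of_finite μ).1 (hw.ae_weighted_iff.1 (coeFn_ofFun (weighted μ w) h))
  let ev : characterSpace μ w → (G → ℂ) →ₗ[ℂ] ℂ := fun φ =>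
    (WeakDual.toStrongDual φ.1).toLinearMap ∘ₗ T
  have hev : ∀ φ h, ev φ h = φ.1 (T h) := fun _ _ => rfl
  have hev_inj : Function.Injective ev := fun φ ψ h => by
    refine Subtype.ext (DFunLike.ext _ _ fun f => ?_)
    have := DFunLike.congr_fun h (⇑f : G → ℂ)
    rwa [hev, hev, ofFun_coeFn] at this
  have hext : ∀ l l' : (G → ℂ) →ₗ[ℂ] ℂ, (∀ x, l (Pi.single x c⁻¹) = l' (Pi.single x c⁻¹)) →
      l = l' := fun l l' h => by
    refine LinearMap.pi_ext fun x a => ?_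
    have h1 : Pi.single x a = (a * c) • (Pi.single x c⁻¹ : G → ℂ) := by
      rw [← Pi.single_smul, smul_eq_mul, mul_inv_cancel_right₀ hc]
    rw [h1, map_smul, map_smul, h]
  have hmul : ∀ φ x y, ev φ (Pi.single (x * y) c⁻¹) =
      ev φ (Pi.single x c⁻¹) * ev φ (Pi.single y c⁻¹) := fun φ x y =>
    φ.2.2 _ _ _ (by rw [hT, hT, hT, conv_single_single])
  -- A nonzero character is nonzero on some point mass, and that factor can be cancelled.
  have hone : ∀ φ, ev φ (Pi.single 1 c⁻¹) = 1 := fun φ => by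
    have h0 : ev φ ≠ 0 := fun h0 => φ.2.1 (DFunLike.ext _ _ fun f => by
      have := DFunLike.congr_fun h0 (⇑f : G → ℂ)
      rwa [hev, ofFun_coeFn] at this)
    obtain ⟨x, hx⟩ : ∃ x, ev φ (Pi.single x c⁻¹) ≠ 0 := by
      by_contra! h
      exact h0 (hext _ _ h)
    have := hmul φ x 1
    rw [mul_one] at this
    exact (mul_eq_left₀ hx).1 this.symm
  let χ : characterSpace μ w → G →* ℂ := fun φ =>
    { toFun := fun x => ev φ (Pi.single x c⁻¹)
      map_one' := hone φ
      map_mul' := hmul φ }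
  have hχ : Function.Injective χ := fun φ ψ h =>
    hev_inj (hext _ _ fun x => DFunLike.congr_fun h x)
  obtain ⟨f, hf⟩ := exists_sum_mul_monoidHom_eq hχ F
  refine ⟨T (∑ x, f x • Pi.single x c⁻¹), funext fun φ => ?_⟩
  change ev φ _ = _
  rw [map_sum, ← hf]
  simp_rw [map_smul]
  rfl

theorem card_le_card_pontryaginDual [Finite (PontryaginDual G)] :
    Nat.card G ≤ Nat.card (PontryaginDual G) := by
  have := Fintype.ofFinite G
  have h1 : Nat.card (AddChar (Additive G) ℂ) = Nat.card G := by
    rw [Nat.card_eq_fintype_card, AddChar.card_eq, Fintype.card_additive, Nat.card_eq_fintype_card]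
  rw [← h1, Nat.card_congr AddChar.circleEquivComplex.toEquiv.symm]
  let j : AddChar (Additive G) Circle → PontryaginDual G := fun ψ =>
    { toFun := fun x => ψ (Additive.ofMul x)
      map_one' := ψ.map_zero_eq_one
      map_mul' := fun x y => ψ.map_add_eq_mul _ _
      continuous_toFun := continuous_of_discreteTopology }
  refine Nat.card_le_card_of_injective j fun ψ ψ' h => ?_
  ext1 x
  exact DFunLike.congr_fun (F := PontryaginDual G) h (Additive.toMul x)

/-- Interpolation gives surjectivity, hence that the dual is no larger than `G`;
`card_le_card_pontryaginDual` gives the reverse bound, and equality of dimensions gives injectivity.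
-/
theorem bijOn_fourierTransform_of_finite :
    Set.BijOn (fourierTransform (G := G) μ) Set.univ
      (Set.range fun F : C₀(PontryaginDual G, ℂ) => (⇑F : PontryaginDual G → ℂ)) := by
  have := Fintype.ofFinite G
  have : Finite (PontryaginDual G) := finite_of_compact_of_discrete
  have hrange : ∀ F : PontryaginDual G → ℂ,
      F ∈ Set.range fun F : C₀(PontryaginDual G, ℂ) => (⇑F : PontryaginDual G → ℂ) := fun F =>
    ⟨⟨⟨F, continuous_of_discreteTopology⟩, by simp⟩, rfl⟩
  let Φ : (G → ℂ) →ₗ[ℂ] PontryaginDual G → ℂ :=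
    LinearMap.pi fun χ => (fourierFunctional μ χ).toLinearMap ∘ₗ ofFun μ
  have hΦ : ∀ h χ, Φ h χ = fourierTransform μ (ofFun μ h) χ := fun _ _ => rfl
  have hsurj : Function.Surjective Φ := fun F => by
    let χ : PontryaginDual G → G →* ℂ := fun χ =>
      (starRingEnd ℂ : ℂ →* ℂ).comp (Circle.coeHom.comp (χ : G →* Circle))
    have hχ : Function.Injective χ := fun a b h => by
      refine DFunLike.ext _ _ fun x => ?_
      have h1 : conj (a x : ℂ) = conj (b x : ℂ) := DFunLike.congr_fun h x
      exact Circle.ext ((starRingEnd ℂ).injective h1)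
    obtain ⟨f, hf⟩ := exists_sum_mul_monoidHom_eq hχ F
    -- Dividing by the mass of each point turns the Haar integral into the plain sum.
    refine ⟨fun x => f x / μ.real {x}, funext fun ψ => ?_⟩
    rw [hΦ, fourierTransform, (ae_eq_iff_eq_of_finite μ).1 (coeFn_ofFun μ _), ← hf,
      integral_fintype Integrable.of_finite]
    refine Finset.sum_congr rfl fun x _ => ?_
    have hx : (μ.real {x} : ℂ) ≠ 0 := by exact_mod_cast (real_singleton_pos μ x).ne'
    change _ = f x * conj (ψ x : ℂ)
    rw [Complex.real_smul]
    field_simp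
  have hinj : Function.Injective Φ := by
    have h1 : Module.finrank ℂ (G → ℂ) = Module.finrank ℂ (PontryaginDual G → ℂ) := by
      have := Fintype.ofFinite (PontryaginDual G)
      refine le_antisymm ?_ (LinearMap.finrank_le_finrank_of_surjective hsurj)
      simpa [Nat.card_eq_fintype_card] using card_le_card_pontryaginDual (G := G)
    exact (LinearMap.injective_iff_surjective_of_finrank_eq_finrank h1).2 hsurj
  refine ⟨fun f _ => hrange _, fun f _ g _ h => ?_, fun F _ => ?_⟩
  · have : Φ f = Φ g := funext fun χ => by
      rw [hΦ, hΦ, ofFun_coeFn, ofFun_coeFn, h]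
    rw [← ofFun_coeFn μ f, hinj this, ofFun_coeFn]
  · obtain ⟨h, hh⟩ := hsurj F
    exact ⟨ofFun μ h, Set.mem_univ _, hh⟩

end FiniteGroup

end WeightedGroupAlgebra

theorem mainTheorem5 {G : Type*} [CommGroup G] [TopologicalSpace G] [IsTopologicalGroup G]
    [LocallyCompactSpace G] [T2Space G] [MeasurableSpace G] [BorelSpace G]
    (μ : Measure G) [μ.IsHaarMeasure] [μ.Regular]
    (w : G → ℝ) (hw : WeightedGroupAlgebra.IsWeight w) :
    List.TFAE [
      ∀ F : C₀(WeightedGroupAlgebra.characterSpace μ w, ℂ),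
        ∃ f : WeightedGroupAlgebra.L1w μ w, WeightedGroupAlgebra.gelfandTransform μ w f = ⇑F,
      Set.BijOn (WeightedGroupAlgebra.fourierTransform (G := G) μ) Set.univ
        (Set.range fun F : C₀(PontryaginDual G, ℂ) => (⇑F : PontryaginDual G → ℂ)),
      Finite G] := by
  tfae_have 1 → 3 := hw.finite_of_surjective_gelfandTransform
  tfae_have 2 → 3 := WeightedGroupAlgebra.finite_of_bijOn_fourierTransform
  tfae_have 3 → 1 := fun _ F => hw.surjective_gelfandTransform_of_finite μ F
  tfae_have 3 → 2 := fun _ => WeightedGroupAlgebra.bijOn_fourierTransform_of_finite μ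
  tfae_finish
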